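/- Let $(M,g)$ be a smooth connected Riemannian manifold (without boundary, Hausdorff and second countable) of dimension $d$, with Riemannian measure $\nu$. For a $C^\infty$ diffeomorphism $\Phi:V\to V'$ between open subsets $V,V'\subset M$ and a compactly supported $\varphi\in C^\infty(M)$ with $\operatorname{supp}\varphi\subset V$, the simple $H$-operator $H_{\varphi,\Phi,V}$ acts on functions $f:M\to\mathbb R$ by $H_{\varphi,\Phi,V}f(x)=\varphi(x)f(\Phi(x))$ for $x\in V$ and $H_{\varphi,\Phi,V}f(x)=0$ for $x\notin V$. An $H$-operator is an operator $H:C_0(M)\to C_0(M)$ that is a finite combination of simple $H$-operators; it is localized on an open set $U\subset M$ if it is a finite combination of simple $H$-operators $H_{\varphi,\Phi,V}$ with $V\subset U$ and $\Phi(V)\subset U$. An $H$-operator acts on an arbitrary function $f:M\to\mathbb R$ by the pointwise formula given by any of its representations as a finite combination of simple $H$-operators (the result does not depend on the representation). Let $\nabla^k f$ be the $k$-th covariant derivative of $f$ with respect to the Levi-Civita connection, given in a local chart by $\nabla^0 f=f$ and $$(\nabla^{k} f)_{i_1\ldots i_{k}}=\partial_{i_1}(\nabla^{k-1}f)_{i_2\ldots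 i_k}-\sum_{\alpha=1}^d\sum_{l=2}^{k}\Gamma^\alpha_{i_1 i_l}(\nabla^{k-1}f)_{i_2\ldots i_{l-1}\alpha i_{l+1}\ldots i_k},$$ and let $|\nabla^k f|^2=\sum_{i_1,\ldots,i_k}\sum_{j_1,\ldots,j_k} g^{i_1j_1}\cdots g^{i_kj_k}(\nabla^k f)_{i_1\ldots i_k}(\nabla^k f)_{j_1\ldots j_k}$, which is independent of the chart. For $r=0,1,\ldots$ let $C^r(M)$ be the space of $C^r$ functions $f:M\to\mathbb R$ with $\|f\|_{C^r}=\sum_{k=0}^r\sup_{x\in M}|\nabla^k f(x)|<\infty$. For $1\le p<\infty$ let $W^r_p(M)$ be the completion of $\{f\in C^\infty(M):\|f\|_{W^r_p}<\infty\}$ with respect to the norm $\|f\|_{W^r_p}=\sum_{k=0}^r\big(\int_M|\nabla^k f|^p\,d\nu\big)^{1/p}$. Theorem. Suppose that $H$ is an $H$-operator localized on an open and precompact set $U\subset M$. Then: (a) for every $r=0,1,\ldots$, the operator $H$ induces a bounded linear operator $H:C^r(M)\to C^r(M)$; that is, $f\mapsto Hf$ maps $C^r(M)$ into itself and is bounded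 in $\|\cdot\|_{C^r}$; (b) for every $r=0,1,\ldots$ and $1\le p<\infty$, the operator $H$ induces a bounded linear operator $H:W^r_p(M)\to W^r_p(M)$; that is, $f\mapsto Hf$ maps $\{f\in C^\infty(M):\|f\|_{W^r_p}<\infty\}$ into itself and extends to a bounded linear operator on $W^r_p(M)$. -/

import Mathlib

open scoped Manifold ContDiff ENNReal ZeroAtInfty Topology
open MeasureTheory

noncomputable section

namespace Hestenes

attribute [local instance 2000] chartedSpaceSelf

/-- Euclidean space `ℝᵈ`. -/
abbrev Euc (d : ℕ) : Type := EuclideanSpace ℝ (Fin d)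

/-- The `i`-th standard basis vector of `ℝᵈ`. -/
abbrev basisVec {d : ℕ} (i : Fin d) : Euc d := EuclideanSpace.single i (1 : ℝ)

/-- The `i`-th partial derivative of a function on `ℝᵈ`. -/
def partialDeriv {d : ℕ} (i : Fin d) (F : Euc d → ℝ) (y : Euc d) : ℝ :=
  fderiv ℝ F y (basisVec i)

section Metric

variable {d : ℕ} {M : Type*} [TopologicalSpace M] [ChartedSpace (Euc d) M]
  [IsManifold 𝓘(ℝ, Euc d) ∞ M]

variable (d M) in
/-- Smooth Riemannian metrics on a smooth `d`-dimensional manifold `M` (without boundary). -/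
abbrev RiemMetric : Type _ :=
  Bundle.ContMDiffRiemannianMetric 𝓘(ℝ, Euc d) ∞ (Euc d)
    (fun x : M => TangentSpace 𝓘(ℝ, Euc d) x)

variable (d M) in
/-- The charts of the smooth structure of `M`: all charts compatible with the given atlas. -/
abbrev smoothCharts : Set (OpenPartialHomeomorph M (Euc d)) :=
  IsManifold.maximalAtlas 𝓘(ℝ, Euc d) ∞ M

/-- The coordinate vector field `∂/∂xᵢ` of the chart `e`, at the point with coordinates `y`. -/
def coordVec (e : OpenPartialHomeomorph M (Euc d)) (i : Fin d) (y : Euc d) :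
    TangentSpace 𝓘(ℝ, Euc d) (e.symm y) :=
  mfderiv 𝓘(ℝ, Euc d) 𝓘(ℝ, Euc d) e.symm y (basisVec i)

/-- The matrix `(g_{ij})` of the metric in the chart `e`, at the point with coordinates `y`. -/
def gram (g : RiemMetric d M) (e : OpenPartialHomeomorph M (Euc d)) (y : Euc d) :
    Matrix (Fin d) (Fin d) ℝ :=
  Matrix.of fun i j => g.inner (e.symm y) (coordVec e i y) (coordVec e j y)

theorem gram_contDiffOn (g : RiemMetric d M) {e : OpenPartialHomeomorph M (Euc d)}
    (he : e ∈ smoothCharts d M) (i j : Fin d) :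
    ContDiffOn ℝ ∞ (fun y => gram g e y i j) e.target := by
  have hsymm := contMDiffOn_symm_of_mem_maximalAtlas he
  have hv : ∀ i : Fin d, ContMDiffOn 𝓘(ℝ, Euc d) (𝓘(ℝ, Euc d).prod 𝓘(ℝ, Euc d)) ∞
      (fun y => (Bundle.TotalSpace.mk' (Euc d) (e.symm y) (coordVec e i y) :
        TangentBundle 𝓘(ℝ, Euc d) M)) e.target := by
    intro i
    have h1 := hsymm.contMDiffOn_tangentMapWithin (m := ∞) (by simp)
      e.open_target.uniqueMDiffOn
    have h2 : ContMDiff 𝓘(ℝ, Euc d) (𝓘(ℝ, Euc d).prod 𝓘(ℝ, Euc d)) ∞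
        (fun y : Euc d => (Bundle.TotalSpace.mk' (Euc d) y (basisVec i : Euc d) :
          TangentBundle 𝓘(ℝ, Euc d) (Euc d))) := by
      intro y
      refine (Bundle.contMDiffAt_section (IB := 𝓘(ℝ, Euc d)) (F := Euc d)
        (E := fun y : Euc d => TangentSpace 𝓘(ℝ, Euc d) y) (s := fun _ => (basisVec i : Euc d)) y).2 ?_
      simpa using contMDiffAt_const
    refine (h1.comp h2.contMDiffOn (fun y hy => hy)).congr ?_
    intro y hy
    simp only [tangentMapWithin, Function.comp_def, coordVec]
    rw [mfderivWithin_of_isOpen e.open_target hy]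
  have h := ContMDiffOn.clm_bundle_apply₂ (F₁ := Euc d) (F₂ := Euc d) (F₃ := ℝ)
    (E₃ := Bundle.Trivial M ℝ)
    (g.contMDiff.comp_contMDiffOn hsymm) (hv i) (hv j)
  intro y hy
  have h3 := h y hy
  rw [Bundle.contMDiffWithinAt_totalSpace] at h3
  exact h3.2.contDiffWithinAt

theorem gram_posDef (g : RiemMetric d M) {e : OpenPartialHomeomorph M (Euc d)}
    (he : e ∈ smoothCharts d M) {y : Euc d} (hy : y ∈ e.target) : (gram g e y).PosDef := by
  have hmd : e.symm.MDifferentiable 𝓘(ℝ, Euc d) 𝓘(ℝ, Euc d) := by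
    refine ⟨(contMDiffOn_symm_of_mem_maximalAtlas he).mdifferentiableOn (by simp), ?_⟩
    exact (contMDiffOn_of_mem_maximalAtlas he).mdifferentiableOn (by simp)
  have hinj := hmd.mfderiv_injective (x := y) hy
  refine Matrix.PosDef.of_dotProduct_mulVec_pos ?_ ?_
  · ext i j
    simp [gram, g.symm]
  · intro x hx
    let D : Euc d →L[ℝ] TangentSpace 𝓘(ℝ, Euc d) (e.symm y) :=
      mfderiv 𝓘(ℝ, Euc d) 𝓘(ℝ, Euc d) e.symm y
    have hinj' : Function.Injective D := hinj
    let v : Euc d := ∑ i, x i • basisVec i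
    have hv : v ≠ 0 := by
      intro h0
      apply hx
      ext i
      have := congrArg (fun w : Euc d => w i) h0
      simpa [v, basisVec, Pi.single_apply] using this
    have hDv : D v ≠ 0 := by
      intro h0
      exact hv (hinj' (h0.trans (map_zero D).symm))
    have hpos := g.pos _ (D v) hDv
    have hsum : D v = ∑ i, x i • coordVec e i y := by
      simp only [v, map_sum, map_smul]
      rfl
    rw [hsum] at hpos
    refine hpos.trans_eq ?_
    simp only [gram, dotProduct, Matrix.mulVec, map_sum, map_smul, Finset.mul_sum,
      _root_.sum_apply, _root_.smul_apply, Matrix.of_apply,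
      smul_eq_mul, star_trivial]
    rw [Finset.sum_comm]
    refine Finset.sum_congr rfl fun i _ => Finset.sum_congr rfl fun j _ => ?_
    ring

/-- The Christoffel symbol `Γ^a_{ij}` of the Levi-Civita connection in the chart `e`:
`Γ^a_{ij} = ½ ∑ₘ g^{am} (∂ᵢ g_{jm} + ∂ⱼ g_{im} - ∂ₘ g_{ij})`. -/
def christoffel (g : RiemMetric d M) (e : OpenPartialHomeomorph M (Euc d)) (a i j : Fin d)
    (y : Euc d) : ℝ :=
  (1 / 2 : ℝ) * ∑ m : Fin d, (gram g e y)⁻¹ a m *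
    (partialDeriv i (fun z => gram g e z j m) y + partialDeriv j (fun z => gram g e z i m) y
      - partialDeriv m (fun z => gram g e z i j) y)

theorem gram_symm (g : RiemMetric d M) (e : OpenPartialHomeomorph M (Euc d)) (y : Euc d)
    (i j : Fin d) : gram g e y i j = gram g e y j i := g.symm _ _ _

/-- The connection with the symbols `christoffel` is torsion-free. -/
theorem christoffel_symm (g : RiemMetric d M) (e : OpenPartialHomeomorph M (Euc d))
    (a i j : Fin d) (y : Euc d) : christoffel g e a i j y = christoffel g e a j i y := by
  simp only [christoffel, gram_symm g e _ i j]
  congr 1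
  refine Finset.sum_congr rfl fun m _ => ?_
  ring

/-- The connection with the symbols `christoffel` satisfies `∇ g = 0`. -/
theorem christoffel_metric (g : RiemMetric d M) {e : OpenPartialHomeomorph M (Euc d)}
    (he : e ∈ smoothCharts d M) {y : Euc d} (hy : y ∈ e.target) (k i j : Fin d) :
    partialDeriv k (fun z => gram g e z i j) y
      = ∑ a, christoffel g e a k i y * gram g e y a j
        + ∑ a, christoffel g e a k j y * gram g e y i a := by
  have hdet : IsUnit (gram g e y).det := (gram_posDef g he hy).det_pos.ne'.isUnit
  have key : ∀ i j : Fin d, ∑ a, christoffel g e a k i y * gram g e y a j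
      = (1 / 2 : ℝ) * (partialDeriv k (fun z => gram g e z i j) y
        + partialDeriv i (fun z => gram g e z k j) y
        - partialDeriv j (fun z => gram g e z k i) y) := by
    intro i j
    have hinv : ∀ m, ∑ a, (gram g e y)⁻¹ a m * gram g e y a j = if m = j then 1 else 0 := by
      intro m
      have h := congrFun (congrFun (Matrix.mul_nonsing_inv _ hdet) j) m
      rw [Matrix.mul_apply, Matrix.one_apply] at h
      simp only [eq_comm (a := m)]
      rw [← h]
      refine Finset.sum_congr rfl fun a _ => ?_
      rw [gram_symm g e y a j]
      ring
    simp only [christoffel, Finset.mul_sum, Finset.sum_mul]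
    rw [Finset.sum_comm]
    have : ∀ m, ∑ a, (1 / 2 : ℝ) * ((gram g e y)⁻¹ a m *
        (partialDeriv k (fun z => gram g e z i m) y + partialDeriv i (fun z => gram g e z k m) y
          - partialDeriv m (fun z => gram g e z k i) y)) * gram g e y a j
        = (1 / 2 : ℝ) * (partialDeriv k (fun z => gram g e z i m) y
          + partialDeriv i (fun z => gram g e z k m) y
          - partialDeriv m (fun z => gram g e z k i) y) * (if m = j then 1 else 0) := by
      intro m
      rw [← hinv m, Finset.mul_sum]
      refine Finset.sum_congr rfl fun a _ => ?_
      ring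
    simp only [this, mul_ite, mul_one, mul_zero, Finset.sum_ite_eq', Finset.mem_univ, if_true]
  have h2 : ∑ a, christoffel g e a k j y * gram g e y i a
      = ∑ a, christoffel g e a k j y * gram g e y a i :=
    Finset.sum_congr rfl fun a _ => by rw [gram_symm g e y i a]
  rw [h2, key i j, key j i]
  simp only [gram_symm g e _ j i]
  ring

/-- The coordinates `(∇ᵏ f)_{i₁ … iₖ}` of the `k`-th covariant derivative of `f` in the chart `e`,
as functions on the range of the chart:
`(∇ᵏ⁺¹ f)_{i₀ i₁ … iₖ} = ∂_{i₀} (∇ᵏ f)_{i₁ … iₖ}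
  - ∑ₗ ∑ₐ Γ^a_{i₀ iₗ} (∇ᵏ f)_{i₁ … a … iₖ}`, where `a` stands in place of `iₗ`. -/
def covCoord (g : RiemMetric d M) (e : OpenPartialHomeomorph M (Euc d)) (f : M → ℝ) :
    (k : ℕ) → (Fin k → Fin d) → Euc d → ℝ
  | 0, _, y => f (e.symm y)
  | k + 1, i, y =>
      partialDeriv (i 0) (fun z => covCoord g e f k (Fin.tail i) z) y
        - ∑ l : Fin k, ∑ a : Fin d, christoffel g e a (i 0) (Fin.tail i l) y
            * covCoord g e f k (Function.update (Fin.tail i) l a) y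

/-- `|∇ᵏ f|(x)`, computed in the chart `e`. -/
def covNormIn (g : RiemMetric d M) (e : OpenPartialHomeomorph M (Euc d)) (k : ℕ) (f : M → ℝ)
    (x : M) : ℝ :=
  Real.sqrt (∑ i : Fin k → Fin d, ∑ j : Fin k → Fin d,
    (∏ l, (gram g e (e x))⁻¹ (i l) (j l)) * covCoord g e f k i (e x) * covCoord g e f k j (e x))

/-- The pointwise norm `|∇ᵏ f|(x)`. Its value does not depend on the chart around `x` in which it
is computed (for `f` of class `Cᵏ`); the supremum selects this common value. -/
def covNorm (g : RiemMetric d M) (k : ℕ) (f : M → ℝ) (x : M) : ℝ≥0∞ :=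
  ⨆ e ∈ smoothCharts d M, ⨆ _ : x ∈ e.source, ENNReal.ofReal (covNormIn g e k f x)

theorem contDiffOn_det {s : Set (Euc d)} {n : ℕ∞ω} {A : Euc d → Matrix (Fin d) (Fin d) ℝ}
    (h : ∀ i j, ContDiffOn ℝ n (fun y => A y i j) s) :
    ContDiffOn ℝ n (fun y => (A y).det) s := by
  simp only [Matrix.det_apply]
  refine ContDiffOn.sum fun σ _ => ContDiffOn.const_smul _ ?_
  exact contDiffOn_prod fun i _ => h _ _

theorem gram_inv_contDiffOn (g : RiemMetric d M) {e : OpenPartialHomeomorph M (Euc d)}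
    (he : e ∈ smoothCharts d M) (i j : Fin d) :
    ContDiffOn ℝ ∞ (fun y => (gram g e y)⁻¹ i j) e.target := by
  have h := gram_contDiffOn g he
  have hadj : ContDiffOn ℝ ∞ (fun y => (gram g e y).adjugate i j) e.target := by
    simp only [Matrix.adjugate_apply]
    refine contDiffOn_det fun a b => ?_
    by_cases hb : a = j
    · subst hb
      simp only [Matrix.updateRow_self]
      exact contDiffOn_const
    · simp only [Matrix.updateRow_ne hb]
      exact h a b
  have hdet := contDiffOn_det h
  refine ((hdet.inv fun y hy => (gram_posDef g he hy).det_pos.ne').mul hadj).congr fun y hy => ?_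
  simp [Matrix.inv_def]

theorem partialDeriv_contDiffOn {s : Set (Euc d)} (hs : IsOpen s) {m n : ℕ∞ω} {F : Euc d → ℝ}
    (hF : ContDiffOn ℝ n F s) (hmn : m + 1 ≤ n) (i : Fin d) :
    ContDiffOn ℝ m (partialDeriv i F) s :=
  (hF.fderiv_of_isOpen hs hmn).clm_apply contDiffOn_const

theorem christoffel_contDiffOn (g : RiemMetric d M) {e : OpenPartialHomeomorph M (Euc d)}
    (he : e ∈ smoothCharts d M) (a i j : Fin d) :
    ContDiffOn ℝ ∞ (christoffel g e a i j) e.target := by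
  have h := gram_contDiffOn g he
  have hp : ∀ l a b, ContDiffOn ℝ ∞ (partialDeriv l (fun z => gram g e z a b)) e.target :=
    fun l a b => partialDeriv_contDiffOn e.open_target (h a b) (by simp) l
  refine ContDiffOn.mul contDiffOn_const (ContDiffOn.sum fun m _ => ?_)
  exact (gram_inv_contDiffOn g he a m).mul (((hp _ _ _).add (hp _ _ _)).sub (hp _ _ _))

theorem covCoord_contDiffOn (g : RiemMetric d M) {e : OpenPartialHomeomorph M (Euc d)}
    (he : e ∈ smoothCharts d M) {f : M → ℝ} (k : ℕ) : ∀ (n : ℕ) (i : Fin k → Fin d),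
    ContMDiff 𝓘(ℝ, Euc d) 𝓘(ℝ) ((n + k : ℕ) : ℕ∞ω) f →
    ContDiffOn ℝ n (covCoord g e f k i) e.target := by
  induction k with
  | zero =>
    intro n i hf
    have h := hf.comp_contMDiffOn ((contMDiffOn_symm_of_mem_maximalAtlas he).of_le
      (show ((n + 0 : ℕ) : ℕ∞ω) ≤ (∞ : ℕ∞ω) by exact_mod_cast le_top))
    exact (contMDiffOn_iff_contDiffOn.1 h)
  | succ k ih =>
    intro n i hf
    have hf' : ContMDiff 𝓘(ℝ, Euc d) 𝓘(ℝ) ((n + 1 + k : ℕ) : ℕ∞ω) f := by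
      convert hf using 2
      omega
    refine ContDiffOn.sub ?_ (ContDiffOn.sum fun l _ => ContDiffOn.sum fun a _ => ?_)
    · exact partialDeriv_contDiffOn e.open_target (ih (n + 1) (Fin.tail i) hf') (by norm_cast) _
    · refine ((christoffel_contDiffOn g he _ _ _).of_le (by exact_mod_cast le_top)).mul ?_
      exact (ih (n + 1) _ hf').of_le (by norm_cast; omega)

theorem covCoord_add (g : RiemMetric d M) {e : OpenPartialHomeomorph M (Euc d)}
    (he : e ∈ smoothCharts d M) {f h : M → ℝ} (k : ℕ)
    (hf : ContMDiff 𝓘(ℝ, Euc d) 𝓘(ℝ) (k : ℕ∞ω) f) (hh : ContMDiff 𝓘(ℝ, Euc d) 𝓘(ℝ) (k : ℕ∞ω) h) :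
    ∀ (i : Fin k → Fin d), ∀ y ∈ e.target,
      covCoord g e (f + h) k i y = covCoord g e f k i y + covCoord g e h k i y := by
  induction k with
  | zero => intro i y hy; rfl
  | succ k ih =>
    intro i y hy
    have hk : ((k : ℕ) : ℕ∞ω) ≤ ((k + 1 : ℕ) : ℕ∞ω) := by norm_cast; omega
    have ih' := ih (hf.of_le hk) (hh.of_le hk)
    have hd : ∀ {u : M → ℝ}, ContMDiff 𝓘(ℝ, Euc d) 𝓘(ℝ) ((k + 1 : ℕ) : ℕ∞ω) u →
        DifferentiableAt ℝ (covCoord g e u k (Fin.tail i)) y := fun {u} hu =>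
      ((covCoord_contDiffOn g he k 1 (Fin.tail i) (by rwa [add_comm])).contDiffAt
        (e.open_target.mem_nhds hy)).differentiableAt (by simp)
    have hp : partialDeriv (i 0) (fun z => covCoord g e (f + h) k (Fin.tail i) z) y
        = partialDeriv (i 0) (fun z => covCoord g e f k (Fin.tail i) z) y
          + partialDeriv (i 0) (fun z => covCoord g e h k (Fin.tail i) z) y := by
      have heq : (fun z => covCoord g e (f + h) k (Fin.tail i) z) =ᶠ[𝓝 y]
          (covCoord g e f k (Fin.tail i) + covCoord g e h k (Fin.tail i)) := by
        filter_upwards [e.open_target.mem_nhds hy] with z hz using ih' _ z hz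
      simp only [partialDeriv]
      rw [heq.fderiv_eq, fderiv_add (hd hf) (hd hh)]
      rfl
    simp only [covCoord, hp, ih' _ y hy, mul_add, Finset.sum_add_distrib]
    ring

theorem covCoord_smul (g : RiemMetric d M) {e : OpenPartialHomeomorph M (Euc d)}
    (he : e ∈ smoothCharts d M) (c : ℝ) {f : M → ℝ} (k : ℕ)
    (hf : ContMDiff 𝓘(ℝ, Euc d) 𝓘(ℝ) (k : ℕ∞ω) f) :
    ∀ (i : Fin k → Fin d), ∀ y ∈ e.target,
      covCoord g e (c • f) k i y = c * covCoord g e f k i y := by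
  induction k with
  | zero => intro i y hy; rfl
  | succ k ih =>
    intro i y hy
    have hk : ((k : ℕ) : ℕ∞ω) ≤ ((k + 1 : ℕ) : ℕ∞ω) := by norm_cast; omega
    have ih' := ih (hf.of_le hk)
    have hd : DifferentiableAt ℝ (covCoord g e f k (Fin.tail i)) y :=
      ((covCoord_contDiffOn g he k 1 (Fin.tail i) (by rwa [add_comm])).contDiffAt
        (e.open_target.mem_nhds hy)).differentiableAt (by simp)
    have hp : partialDeriv (i 0) (fun z => covCoord g e (c • f) k (Fin.tail i) z) y
        = c * partialDeriv (i 0) (fun z => covCoord g e f k (Fin.tail i) z) y := by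
      have heq : (fun z => covCoord g e (c • f) k (Fin.tail i) z) =ᶠ[𝓝 y]
          (c • covCoord g e f k (Fin.tail i)) := by
        filter_upwards [e.open_target.mem_nhds hy] with z hz using ih' _ z hz
      simp only [partialDeriv]
      rw [heq.fderiv_eq, fderiv_const_smul hd]
      rfl
    simp only [covCoord, hp, ih' _ y hy, mul_sub, Finset.mul_sum]
    congr 1
    refine Finset.sum_congr rfl fun l _ => Finset.sum_congr rfl fun a _ => ?_
    ring

open scoped MatrixOrder in
theorem exists_factor {A : Matrix (Fin d) (Fin d) ℝ} (hA : A.PosSemidef) :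
    ∃ B : Matrix (Fin d) (Fin d) ℝ, A = B.conjTranspose * B := by
  obtain ⟨B, hB, -, h⟩ := CFC.exists_sqrt_of_isSelfAdjoint_of_quasispectrumRestricts
    hA.isHermitian (QuasispectrumRestricts.nnreal_of_nonneg hA.nonneg)
  refine ⟨B, h.symm.trans ?_⟩
  rw [show B.conjTranspose = B from hB]

/-- The norm on `k`-tensors induced by a positive semidefinite matrix is a Euclidean norm. -/
theorem exists_tensorNorm {A : Matrix (Fin d) (Fin d) ℝ} (hA : A.PosSemidef) (k : ℕ) :
    ∃ L : ((Fin k → Fin d) → ℝ) →ₗ[ℝ] EuclideanSpace ℝ (Fin k → Fin d),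
      ∀ T : (Fin k → Fin d) → ℝ, Real.sqrt (∑ i : Fin k → Fin d, ∑ j : Fin k → Fin d,
        (∏ l, A (i l) (j l)) * T i * T j) = ‖L T‖ := by
  obtain ⟨B, rfl⟩ := exists_factor hA
  refine ⟨{ toFun := fun T => WithLp.toLp 2 fun m => ∑ i, (∏ l, B (m l) (i l)) * T i
            map_add' := ?_
            map_smul' := ?_ }, fun T => ?_⟩
  · intro T S
    ext m
    simp [mul_add, Finset.sum_add_distrib]
  · intro c T
    ext m
    simp only [Pi.smul_apply, smul_eq_mul, Finset.mul_sum, RingHom.id_apply, PiLp.smul_apply]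
    refine Finset.sum_congr rfl fun i _ => ?_
    ring
  · rw [EuclideanSpace.norm_eq]
    congr 1
    simp only [LinearMap.coe_mk, AddHom.coe_mk, Real.norm_eq_abs, sq_abs]
    simp only [sq, Finset.sum_mul_sum]
    rw [Finset.sum_comm]
    rw [Finset.sum_comm (s := Finset.univ) (t := Finset.univ)]
    conv_rhs => rw [Finset.sum_comm]
    refine Finset.sum_congr rfl fun i _ => ?_
    conv_rhs => rw [Finset.sum_comm]
    refine Finset.sum_congr rfl fun j _ => ?_
    simp only [Matrix.mul_apply, Matrix.conjTranspose_apply, star_trivial]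
    rw [Finset.prod_univ_sum, Finset.sum_mul, Finset.sum_mul, Fintype.piFinset_univ]
    refine Finset.sum_congr rfl fun m _ => ?_
    rw [Finset.prod_mul_distrib]
    ring

theorem covNorm_add_le (g : RiemMetric d M) (k : ℕ) {f h : M → ℝ}
    (hf : ContMDiff 𝓘(ℝ, Euc d) 𝓘(ℝ) (k : ℕ∞ω) f) (hh : ContMDiff 𝓘(ℝ, Euc d) 𝓘(ℝ) (k : ℕ∞ω) h)
    (x : M) : covNorm g k (f + h) x ≤ covNorm g k f x + covNorm g k h x := by
  refine iSup₂_le fun e he => iSup_le fun hx => ?_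
  have hle : ∀ u : M → ℝ, ENNReal.ofReal (covNormIn g e k u x) ≤ covNorm g k u x := fun u =>
    le_iSup₂_of_le e he (le_iSup_of_le hx le_rfl)
  refine le_trans ?_ (add_le_add (hle f) (hle h))
  have hnn : ∀ u : M → ℝ, 0 ≤ covNormIn g e k u x := fun u => Real.sqrt_nonneg _
  rw [← ENNReal.ofReal_add (hnn f) (hnn h)]
  apply ENNReal.ofReal_le_ofReal
  obtain ⟨L, hL⟩ := exists_tensorNorm (gram_posDef g he (e.map_source hx)).inv.posSemidef k
  simp only [covNormIn]
  rw [hL (fun i => covCoord g e (f + h) k i (e x)), hL (fun i => covCoord g e f k i (e x)),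
    hL (fun i => covCoord g e h k i (e x))]
  refine le_trans (le_of_eq ?_) (norm_add_le _ _)
  rw [← map_add]
  congr 2
  ext i
  exact covCoord_add g he k hf hh i _ (e.map_source hx)

theorem covNorm_smul (g : RiemMetric d M) (k : ℕ) (c : ℝ) {f : M → ℝ}
    (hf : ContMDiff 𝓘(ℝ, Euc d) 𝓘(ℝ) (k : ℕ∞ω) f) (x : M) :
    covNorm g k (c • f) x = ENNReal.ofReal |c| * covNorm g k f x := by
  simp only [covNorm, ENNReal.mul_iSup]
  refine iSup_congr fun e => iSup_congr fun he => iSup_congr fun hx => ?_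
  rw [← ENNReal.ofReal_mul (abs_nonneg c)]
  congr 1
  simp only [covNormIn]
  rw [← Real.sqrt_sq_eq_abs, ← Real.sqrt_mul (sq_nonneg c)]
  congr 1
  simp only [Finset.mul_sum]
  refine Finset.sum_congr rfl fun i _ => Finset.sum_congr rfl fun j _ => ?_
  rw [covCoord_smul g he c k hf _ _ (e.map_source hx),
    covCoord_smul g he c k hf _ _ (e.map_source hx)]
  ring

theorem le_covNorm_zero (g : RiemMetric d M) (f : M → ℝ) (x : M) :
    ENNReal.ofReal |f x| ≤ covNorm g 0 f x := by
  have hx := mem_chart_source (Euc d) x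
  refine le_iSup₂_of_le (chartAt (Euc d) x) (IsManifold.chart_mem_maximalAtlas x)
    (le_iSup_of_le hx ?_)
  simp [covNormIn, covCoord, hx, Real.sqrt_mul_self_eq_abs]

theorem measurable_covNorm [MeasurableSpace M] [BorelSpace M] (g : RiemMetric d M) (k : ℕ)
    {f : M → ℝ} (hf : ContMDiff 𝓘(ℝ, Euc d) 𝓘(ℝ) (k : ℕ∞ω) f) : Measurable (covNorm g k f) := by
  apply LowerSemicontinuous.measurable
  refine lowerSemicontinuous_biSup fun e he => ?_
  have hc : ContinuousOn (fun x => ENNReal.ofReal (covNormIn g e k f x)) e.source := by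
    have h0 : ContinuousOn (fun x => covNormIn g e k f x) e.source := by
      refine Real.continuous_sqrt.comp_continuousOn ?_
      refine continuousOn_finsetSum _ fun i _ => continuousOn_finsetSum _ fun j _ => ?_
      have hcov : ∀ i, ContinuousOn (fun x => covCoord g e f k i (e x)) e.source := fun i =>
        (covCoord_contDiffOn g he k 0 i (by simpa using hf)).continuousOn.comp e.continuousOn
          e.mapsTo
      refine (ContinuousOn.mul ?_ (hcov i)).mul (hcov j)
      exact continuousOn_finsetProd _ fun l _ =>
        (gram_inv_contDiffOn g he _ _).continuousOn.comp e.continuousOn e.mapsTo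
    exact ENNReal.continuous_ofReal.comp_continuousOn h0
  intro x c hcx
  by_cases hx : x ∈ e.source
  · have hcx' : c < ENNReal.ofReal (covNormIn g e k f x) := by simpa [hx] using hcx
    filter_upwards [e.open_source.mem_nhds hx,
      (hc.continuousAt (e.open_source.mem_nhds hx)).eventually_const_lt hcx'] with z hz hz'
    simpa [hz] using hz'
  · simp [hx] at hcx

/-! ### The spaces `Cʳ(M)` -/

/-- `‖f‖_{Cʳ} = ∑_{k ≤ r} sup_x |∇ᵏ f(x)|`, with values in `[0, ∞]`. -/
def crNorm (g : RiemMetric d M) (r : ℕ) (f : M → ℝ) : ℝ≥0∞ :=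
  ∑ k ∈ Finset.range (r + 1), ⨆ x, covNorm g k f x

theorem crNorm_add_le (g : RiemMetric d M) (r : ℕ) {f h : M → ℝ}
    (hf : ContMDiff 𝓘(ℝ, Euc d) 𝓘(ℝ) (r : ℕ∞ω) f) (hh : ContMDiff 𝓘(ℝ, Euc d) 𝓘(ℝ) (r : ℕ∞ω) h) :
    crNorm g r (f + h) ≤ crNorm g r f + crNorm g r h := by
  simp only [crNorm, ← Finset.sum_add_distrib]
  refine Finset.sum_le_sum fun k hk => iSup_le fun x => ?_
  have hk' : ((k : ℕ) : ℕ∞ω) ≤ (r : ℕ∞ω) := by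
    have := Finset.mem_range.1 hk
    exact_mod_cast Nat.lt_succ_iff.1 this
  exact (covNorm_add_le g k (hf.of_le hk') (hh.of_le hk') x).trans
    (add_le_add (le_iSup _ x) (le_iSup _ x))

theorem crNorm_smul (g : RiemMetric d M) (r : ℕ) (c : ℝ) {f : M → ℝ}
    (hf : ContMDiff 𝓘(ℝ, Euc d) 𝓘(ℝ) (r : ℕ∞ω) f) :
    crNorm g r (c • f) = ENNReal.ofReal |c| * crNorm g r f := by
  simp only [crNorm, Finset.mul_sum]
  refine Finset.sum_congr rfl fun k hk => ?_
  have hk' : ((k : ℕ) : ℕ∞ω) ≤ (r : ℕ∞ω) := by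
    have := Finset.mem_range.1 hk
    exact_mod_cast Nat.lt_succ_iff.1 this
  simp only [covNorm_smul g k c (hf.of_le hk'), ENNReal.mul_iSup]

/-- The seminorm given by an extended-real-valued norm that takes finite values. -/
def normOf {V : Type*} [AddCommGroup V] [Module ℝ V] (N : V → ℝ≥0∞) (hfin : ∀ v, N v ≠ ⊤)
    (hadd : ∀ v w, N (v + w) ≤ N v + N w)
    (hsmul : ∀ (c : ℝ) v, N (c • v) = ENNReal.ofReal |c| * N v) : Seminorm ℝ V :=
  Seminorm.of (fun v => (N v).toReal)
    (fun v w => (ENNReal.toReal_mono (ENNReal.add_ne_top.2 ⟨hfin v, hfin w⟩) (hadd v w)).trans_eq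
      (ENNReal.toReal_add (hfin v) (hfin w)))
    (fun c v => by
      rw [hsmul, ENNReal.toReal_mul, ENNReal.toReal_ofReal (abs_nonneg c), Real.norm_eq_abs])

/-- The functions of class `Cʳ` with finite `Cʳ`-norm. -/
def crSubmodule (g : RiemMetric d M) (r : ℕ) : Submodule ℝ (M → ℝ) where
  carrier := {f | ContMDiff 𝓘(ℝ, Euc d) 𝓘(ℝ) (r : ℕ∞ω) f ∧ crNorm g r f < ⊤}
  add_mem' {f h} hf hh := ⟨hf.1.add hh.1,
    (crNorm_add_le g r hf.1 hh.1).trans_lt (ENNReal.add_lt_top.2 ⟨hf.2, hh.2⟩)⟩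
  zero_mem' := ⟨contMDiff_const, by
    have h := crNorm_smul g r 0 (f := (0 : M → ℝ)) contMDiff_const
    simp only [zero_smul, abs_zero, ENNReal.ofReal_zero, zero_mul] at h
    rw [h]
    exact ENNReal.zero_lt_top⟩
  smul_mem' c f hf := ⟨show ContMDiff 𝓘(ℝ, Euc d) 𝓘(ℝ) _ (fun x => c * f x) from contMDiff_const.mul hf.1, by
    rw [crNorm_smul g r c hf.1]
    exact ENNReal.mul_lt_top ENNReal.ofReal_lt_top hf.2⟩

/-- The space `Cʳ(M)`. -/
def CrSpace (g : RiemMetric d M) (r : ℕ) : Type _ := ↥(crSubmodule g r)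

namespace CrSpace

variable (g : RiemMetric d M) (r : ℕ)

/-- The function underlying an element of `Cʳ(M)`. -/
def toFun {g : RiemMetric d M} {r : ℕ} (f : CrSpace g r) : M → ℝ := f.1

theorem property {g : RiemMetric d M} {r : ℕ} (f : CrSpace g r) :
    ContMDiff 𝓘(ℝ, Euc d) 𝓘(ℝ) (r : ℕ∞ω) f.toFun ∧ crNorm g r f.toFun < ⊤ := f.2

instance : AddCommGroup (CrSpace g r) := inferInstanceAs (AddCommGroup ↥(crSubmodule g r))

instance : Module ℝ (CrSpace g r) := inferInstanceAs (Module ℝ ↥(crSubmodule g r))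

/-- The norm of `Cʳ(M)`. -/
def seminorm : Seminorm ℝ (CrSpace g r) :=
  normOf (fun f => crNorm g r f.toFun) (fun f => f.property.2.ne)
    (fun f h => crNorm_add_le g r f.property.1 h.property.1) (fun c f => crNorm_smul g r c f.property.1)

theorem eq_zero_of_seminorm (f : CrSpace g r) (hf : seminorm g r f = 0) : f = 0 := by
  have h0 : crNorm g r f.toFun = 0 :=
    ((ENNReal.toReal_eq_zero_iff _).1 hf).resolve_right f.property.2.ne
  apply Subtype.ext
  funext x
  have h1 := le_covNorm_zero g f.toFun x
  have h2 : (⨆ x, covNorm g 0 f.toFun x) = 0 :=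
    (Finset.sum_eq_zero_iff.1 h0) 0 (Finset.mem_range.2 (Nat.succ_pos r))
  have h3 : covNorm g 0 f.toFun x = 0 := le_antisymm ((le_iSup _ x).trans h2.le) bot_le
  rw [h3] at h1
  exact abs_eq_zero.1 (le_antisymm (ENNReal.ofReal_eq_zero.1 (le_antisymm h1 bot_le)) (abs_nonneg _))

instance : NormedAddCommGroup (CrSpace g r) :=
  AddGroupNorm.toNormedAddCommGroup
    { (seminorm g r).toAddGroupSeminorm with
      eq_zero_of_map_eq_zero' := eq_zero_of_seminorm g r }

instance : NormedSpace ℝ (CrSpace g r) where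
  norm_smul_le c f := (map_smul_eq_mul (seminorm g r) c f).le

theorem norm_def (f : CrSpace g r) : ‖f‖ = (crNorm g r f.toFun).toReal := rfl

end CrSpace

/-! ### H-operators -/

variable (d M) in
/-- The data `(φ, Φ, V)` of a simple H-operator: a `C^∞` diffeomorphism `Φ : V → V'` between open
subsets `V = Φ.source` and `V' = Φ.target` of `M`, and a compactly supported smooth function `φ`
with `supp φ ⊆ V`. -/
structure SimpleH where
  Φ : PartialDiffeomorph 𝓘(ℝ, Euc d) 𝓘(ℝ, Euc d) M M ∞
  φ : M → ℝ
  contMDiff_φ : ContMDiff 𝓘(ℝ, Euc d) 𝓘(ℝ) ∞ φ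
  hasCompactSupport_φ : HasCompactSupport φ
  tsupport_subset : tsupport φ ⊆ Φ.source

namespace SimpleH

/-- The open set `V`. -/
def V (S : SimpleH d M) : Set M := S.Φ.source

open Classical in
/-- The simple H-operator acting on an arbitrary function `f : M → ℝ`:
`φ(x) f(Φ(x))` for `x ∈ V`, and `0` for `x ∉ V`. -/
def act (S : SimpleH d M) (f : M → ℝ) (x : M) : ℝ :=
  if x ∈ S.V then S.φ x * f (S.Φ x) else 0

set_option linter.unusedSectionVars false in
theorem act_eq_zero (S : SimpleH d M) (f : M → ℝ) {x : M} (hx : x ∉ tsupport S.φ) :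
    S.act f x = 0 := by
  simp [act, image_eq_zero_of_notMem_tsupport hx]

theorem continuous_act (S : SimpleH d M) {f : M → ℝ} (hf : Continuous f) :
    Continuous (S.act f) := by
  rw [continuous_iff_continuousAt]
  intro x
  by_cases hx : x ∈ S.V
  · have hV : S.V ∈ 𝓝 x := S.Φ.open_source.mem_nhds hx
    have h : ContinuousAt (fun z => S.φ z * f (S.Φ z)) x :=
      S.contMDiff_φ.continuous.continuousAt.mul (hf.continuousAt.comp
        (S.Φ.contMDiffOn_toFun.continuousOn.continuousAt hV))
    refine h.congr ?_
    filter_upwards [hV] with z hz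
    simp [act, hz]
  · have hx' : x ∈ (tsupport S.φ)ᶜ := fun h => hx (S.tsupport_subset h)
    refine (continuousAt_const (y := (0 : ℝ))).congr ?_
    filter_upwards [(isClosed_tsupport S.φ).isOpen_compl.mem_nhds hx'] with z hz
    exact (S.act_eq_zero f hz).symm

theorem hasCompactSupport_act [T2Space M] (S : SimpleH d M) (f : M → ℝ) :
    HasCompactSupport (S.act f) :=
  HasCompactSupport.intro S.hasCompactSupport_φ fun _ hx => S.act_eq_zero f hx

/-- The simple H-operator as a bounded linear operator on `C₀(M)`. -/
def toC0 [T2Space M] (S : SimpleH d M) : C₀(M, ℝ) →L[ℝ] C₀(M, ℝ) :=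
  LinearMap.mkContinuousOfExistsBound
    { toFun := fun f =>
        { toFun := S.act f
          continuous_toFun := S.continuous_act f.continuous
          zero_at_infty' := (S.hasCompactSupport_act f).is_zero_at_infty }
      map_add' := fun f h => by
        ext x
        by_cases hx : x ∈ S.V <;> simp [act, hx, mul_add]
      map_smul' := fun c f => by
        ext x
        by_cases hx : x ∈ S.V <;> simp [act, hx, mul_left_comm] }
    (by
      obtain ⟨C, hC⟩ := S.hasCompactSupport_φ.exists_bound_of_continuous S.contMDiff_φ.continuous
      refine ⟨max C 0, fun f => ?_⟩
      rw [← ZeroAtInftyContinuousMap.norm_toBCF_eq_norm, ← ZeroAtInftyContinuousMap.norm_toBCF_eq_norm,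
        BoundedContinuousFunction.norm_le (by positivity)]
      intro x
      have hfx : ∀ z, ‖f z‖ ≤ ‖f.toBCF‖ := fun z => f.toBCF.norm_coe_le_norm z
      change ‖S.act f x‖ ≤ _
      by_cases hx : x ∈ S.V
      · simp only [act, hx, if_true, norm_mul]
        exact mul_le_mul ((hC x).trans (le_max_left _ _)) (hfx _) (norm_nonneg _) (le_max_right _ _)
      · simp only [act, hx, if_false, norm_zero]
        positivity)

theorem toC0_apply [T2Space M] (S : SimpleH d M) (f : C₀(M, ℝ)) (x : M) :
    S.toC0 f x = S.act f x := rfl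

end SimpleH

/-- The finite family `S` of simple H-operators represents `H`, i.e. `H = ∑ᵢ Sᵢ` on `C₀(M)`.
(Scalar coefficients are absorbed in the functions `φ`.) -/
def Represents [T2Space M] {n : ℕ} (S : Fin n → SimpleH d M) (H : C₀(M, ℝ) →L[ℝ] C₀(M, ℝ)) : Prop :=
  H = ∑ i, (S i).toC0

/-- `H` is an H-operator localized on `U`: a finite combination of simple H-operators
with `V ⊆ U` and `Φ(V) ⊆ U`. -/
def IsLocalizedHOperator [T2Space M] (H : C₀(M, ℝ) →L[ℝ] C₀(M, ℝ)) (U : Set M) : Prop :=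
  ∃ (n : ℕ) (S : Fin n → SimpleH d M),
    (∀ i, (S i).V ⊆ U ∧ (S i).Φ '' (S i).V ⊆ U) ∧ Represents S H

/-- The action of an H-operator on arbitrary functions: `h = H f`, where `H f` is computed pointwise
from any representation of `H` as a finite sum of simple H-operators. -/
def ActsTo [T2Space M] (H : C₀(M, ℝ) →L[ℝ] C₀(M, ℝ)) (f h : M → ℝ) : Prop :=
  ∀ (n : ℕ) (S : Fin n → SimpleH d M), Represents S H → ∀ x, h x = ∑ i, (S i).act f x

/-! ### The Riemannian measure -/

variable [MeasurableSpace M] [BorelSpace M]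

/-- The Riemannian measure on the domain of the chart `e`: the measure `√det(g_{ij}) dy` on the
range of the chart, transported to `M`. -/
def chartMeasure (g : RiemMetric d M) (e : OpenPartialHomeomorph M (Euc d)) : Measure M :=
  ((volume.restrict e.target).withDensity
    fun y => ENNReal.ofReal (Real.sqrt (gram g e y).det)).map e.symm

theorem chartMeasure_apply (g : RiemMetric d M) {e : OpenPartialHomeomorph M (Euc d)}
    {s : Set M} (hs : MeasurableSet s) :
    chartMeasure g e s = ∫⁻ y in e.symm ⁻¹' s ∩ e.target,
      ENNReal.ofReal (Real.sqrt (gram g e y).det) := by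
  have h0 : AEMeasurable e.symm (volume.restrict e.target) :=
    e.continuousOn_symm.aemeasurable e.open_target.measurableSet
  have h1 : NullMeasurableSet (e.symm ⁻¹' s) (volume.restrict e.target) :=
    h0.nullMeasurable hs
  rw [chartMeasure, Measure.map_apply_of_aemeasurable
    (h0.mono_ac (withDensity_absolutelyContinuous _ _)) hs, withDensity_apply₀ _ h1,
    Measure.restrict_restrict₀ h1]

/-- The Riemannian measure of `(M, g)`. The measures `chartMeasure g e` agree on the overlaps of the
chart domains; their supremum is the Borel measure that restricts to each of them. -/
def riemMeasure (g : RiemMetric d M) : Measure M :=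
  ⨆ e ∈ smoothCharts d M, chartMeasure g e

/-! ### The Sobolev spaces `Wʳₚ(M)` -/

/-- `‖f‖_{Wʳₚ} = ∑_{k ≤ r} (∫ |∇ᵏ f|ᵖ dν)^{1/p}`, with values in `[0, ∞]`. -/
def sobolevNorm (g : RiemMetric d M) (r : ℕ) (p : ℝ) (f : M → ℝ) : ℝ≥0∞ :=
  ∑ k ∈ Finset.range (r + 1), (∫⁻ x, covNorm g k f x ^ p ∂(riemMeasure g)) ^ (1 / p)

theorem sobolevNorm_add_le (g : RiemMetric d M) (r : ℕ) {p : ℝ} (hp : 1 ≤ p) {f h : M → ℝ}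
    (hf : ContMDiff 𝓘(ℝ, Euc d) 𝓘(ℝ) ∞ f) (hh : ContMDiff 𝓘(ℝ, Euc d) 𝓘(ℝ) ∞ h) :
    sobolevNorm g r p (f + h) ≤ sobolevNorm g r p f + sobolevNorm g r p h := by
  simp only [sobolevNorm, ← Finset.sum_add_distrib]
  refine Finset.sum_le_sum fun k _ => ?_
  have hk : ((k : ℕ) : ℕ∞ω) ≤ (∞ : ℕ∞ω) := by exact_mod_cast le_top
  have hp0 : 0 ≤ p := by linarith
  refine le_trans ?_ (ENNReal.lintegral_Lp_add_le (measurable_covNorm g k (hf.of_le hk)).aemeasurable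
    (measurable_covNorm g k (hh.of_le hk)).aemeasurable hp)
  refine ENNReal.rpow_le_rpow (lintegral_mono fun x => ENNReal.rpow_le_rpow ?_ hp0) (by positivity)
  exact covNorm_add_le g k (hf.of_le hk) (hh.of_le hk) x

theorem sobolevNorm_smul (g : RiemMetric d M) (r : ℕ) {p : ℝ} (hp : 1 ≤ p) (c : ℝ) {f : M → ℝ}
    (hf : ContMDiff 𝓘(ℝ, Euc d) 𝓘(ℝ) ∞ f) :
    sobolevNorm g r p (c • f) = ENNReal.ofReal |c| * sobolevNorm g r p f := by
  simp only [sobolevNorm, Finset.mul_sum]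
  refine Finset.sum_congr rfl fun k _ => ?_
  have hk : ((k : ℕ) : ℕ∞ω) ≤ (∞ : ℕ∞ω) := by exact_mod_cast le_top
  have hp0 : 0 < p := by linarith
  simp only [covNorm_smul g k c (hf.of_le hk), ENNReal.mul_rpow_of_nonneg _ _ hp0.le]
  rw [lintegral_const_mul _ ((measurable_covNorm g k (hf.of_le hk)).pow_const p),
    ENNReal.mul_rpow_of_nonneg _ _ (by positivity), ← ENNReal.rpow_mul,
    mul_one_div_cancel hp0.ne', ENNReal.rpow_one]

/-- The smooth functions on `M` with finite `Wʳₚ`-norm. -/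
def sobolevSubmodule (g : RiemMetric d M) (r : ℕ) (p : ℝ) (hp : 1 ≤ p) :
    Submodule ℝ (M → ℝ) where
  carrier := {f | ContMDiff 𝓘(ℝ, Euc d) 𝓘(ℝ) ∞ f ∧ sobolevNorm g r p f < ⊤}
  add_mem' {f h} hf hh := ⟨hf.1.add hh.1,
    (sobolevNorm_add_le g r hp hf.1 hh.1).trans_lt (ENNReal.add_lt_top.2 ⟨hf.2, hh.2⟩)⟩
  zero_mem' := ⟨contMDiff_const, by
    have h := sobolevNorm_smul g r hp 0 (f := (0 : M → ℝ)) contMDiff_const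
    simp only [zero_smul, abs_zero, ENNReal.ofReal_zero, zero_mul] at h
    rw [h]
    exact ENNReal.zero_lt_top⟩
  smul_mem' c f hf := ⟨show ContMDiff 𝓘(ℝ, Euc d) 𝓘(ℝ) _ (fun x => c * f x) from contMDiff_const.mul hf.1, by
    rw [sobolevNorm_smul g r hp c hf.1]
    exact ENNReal.mul_lt_top ENNReal.ofReal_lt_top hf.2⟩

/-- The space of smooth functions on `M` with finite `Wʳₚ`-norm, equipped with that norm. -/
def SmoothSobolev (g : RiemMetric d M) (r : ℕ) (p : ℝ) (hp : 1 ≤ p) : Type _ :=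
  ↥(sobolevSubmodule g r p hp)

namespace SmoothSobolev

variable (g : RiemMetric d M) (r : ℕ) (p : ℝ) (hp : 1 ≤ p)

/-- The underlying smooth function. -/
def toFun {g : RiemMetric d M} {r : ℕ} {p : ℝ} {hp : 1 ≤ p} (f : SmoothSobolev g r p hp) :
    M → ℝ := f.1

theorem property {g : RiemMetric d M} {r : ℕ} {p : ℝ} {hp : 1 ≤ p} (f : SmoothSobolev g r p hp) :
    ContMDiff 𝓘(ℝ, Euc d) 𝓘(ℝ) ∞ f.toFun ∧ sobolevNorm g r p f.toFun < ⊤ := f.2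

instance : AddCommGroup (SmoothSobolev g r p hp) :=
  inferInstanceAs (AddCommGroup ↥(sobolevSubmodule g r p hp))

instance : Module ℝ (SmoothSobolev g r p hp) :=
  inferInstanceAs (Module ℝ ↥(sobolevSubmodule g r p hp))

/-- The norm `‖·‖_{Wʳₚ}`. -/
def seminorm : Seminorm ℝ (SmoothSobolev g r p hp) :=
  normOf (fun f => sobolevNorm g r p f.toFun) (fun f => f.property.2.ne)
    (fun f h => sobolevNorm_add_le g r hp f.property.1 h.property.1)
    (fun c f => sobolevNorm_smul g r hp c f.property.1)

instance : SeminormedAddCommGroup (SmoothSobolev g r p hp) :=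
  AddGroupSeminorm.toSeminormedAddCommGroup (seminorm g r p hp).toAddGroupSeminorm

instance : NormedSpace ℝ (SmoothSobolev g r p hp) where
  norm_smul_le c f := (map_smul_eq_mul (seminorm g r p hp) c f).le

theorem norm_def (f : SmoothSobolev g r p hp) : ‖f‖ = (sobolevNorm g r p f.toFun).toReal := rfl

end SmoothSobolev

/-- The Sobolev space `Wʳₚ(M)`: the completion of the space of smooth functions with finite
`Wʳₚ`-norm with respect to this norm. -/
abbrev Sobolev (g : RiemMetric d M) (r : ℕ) (p : ℝ) (hp : 1 ≤ p) : Type _ :=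
  UniformSpace.Completion (SmoothSobolev g r p hp)

/-- The canonical map of a smooth function with finite `Wʳₚ`-norm to the Sobolev space. -/
def toSobolev {g : RiemMetric d M} {r : ℕ} {p : ℝ} {hp : 1 ≤ p} (f : SmoothSobolev g r p hp) :
    Sobolev g r p hp := (f : UniformSpace.Completion (SmoothSobolev g r p hp))

end Metric
end Hestenes

end

/-! A simple H-operator multiplies by `φ` and composes with `Φ`, so both claims reduce to two local
estimates, made uniform by compactness of `tsupport φ`.

Pointwise estimate: near a point of the support, `|∇ᵏ(Hf)|(z) ≤ C ∑_{j≤k} |∇ʲ f|(Φ z)` with `C`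
independent of `f` (`exists_covNorm_act_le`). Take a chart `e` at `x` and the chart `e' = e ∘ Φ⁻¹`
near `Φ x`. In this pair of charts `Φ` is the identity, so `f` and `f ∘ Φ` have the same coordinate
expression `F`, and only the connection changes. The components of `∇ᵏ(φF)` for the connection of
`e` are smooth combinations of components of `∇ʲF`, `j ≤ k`, for that of `e'`
(`LowerComb.covDeriv_mul`). Locally the coefficients are bounded, and the metric norms control
components and are controlled by them (`abs_le_sqrt_tensorQuad`, `sqrt_tensorQuad_le`).

Measure estimate: in the same charts `Φ` only replaces one positive continuous density `√det g` by
another, so integrals of `u ∘ Φ` over the support are at most a constant times those of `u`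
(`exists_lintegral_comp_le`).

Since `covNorm` and `riemMeasure` are suprema over all smooth charts, an upper bound found in one
chart is useful only after chart independence is known. For `covNorm` this is the tensor law for
`∇ᵏf` (`covDeriv_comp`), which rests on the transformation law of the Christoffel symbols
(`christoffel_transition`). For the measure it is the change of variables formula
(`chartMeasure_inter_le`). Summing simple operators, and extending by density in the Sobolev case,
gives the theorem. That the limiting formula is the action of `H` follows from
`sum_act_eq_of_represents`. -/

noncomputable section

namespace Hestenes

attribute [local instance 2000] chartedSpaceSelf

set_option linter.unusedSectionVars false

/-! ### Covariant derivatives on open subsets of `ℝᵈ` for an arbitrary connection. -/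

section Euclidean

variable {d : ℕ}

/-- Iterated covariant derivatives of a function on `ℝᵈ` with respect to the connection with
symbols `Γ a i j`. -/
def covDeriv (Γ : Fin d → Fin d → Fin d → Euc d → ℝ) (F : Euc d → ℝ) :
    (k : ℕ) → (Fin k → Fin d) → Euc d → ℝ
  | 0, _, y => F y
  | k + 1, i, y =>
      partialDeriv (i 0) (fun z => covDeriv Γ F k (Fin.tail i) z) y
        - ∑ l : Fin k, ∑ a : Fin d, Γ a (i 0) (Fin.tail i l) y
            * covDeriv Γ F k (Function.update (Fin.tail i) l a) y

/-- Separates the connection from the function, so that two connections coming from different charts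
can be compared on the same open set of `ℝᵈ`. -/
theorem covCoord_eq_covDeriv {M : Type*} [TopologicalSpace M] [ChartedSpace (Euc d) M]
    [IsManifold 𝓘(ℝ, Euc d) ∞ M] (g : RiemMetric d M) (e : OpenPartialHomeomorph M (Euc d))
    (f : M → ℝ) (k : ℕ) : ∀ (i : Fin k → Fin d) (y : Euc d),
    covCoord g e f k i y = covDeriv (christoffel g e) (fun z => f (e.symm z)) k i y := by
  induction k with
  | zero => intro i y; rfl
  | succ k ih => intro i y; simp only [covCoord, covDeriv, ih]

theorem partialDeriv_congr_of_isOpen {s : Set (Euc d)} (hs : IsOpen s) {F G : Euc d → ℝ}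
    (h : ∀ z ∈ s, F z = G z) {y : Euc d} (hy : y ∈ s) (i : Fin d) :
    partialDeriv i F y = partialDeriv i G y := by
  have heq : F =ᶠ[𝓝 y] G := by
    filter_upwards [hs.mem_nhds hy] with z hz using h z hz
  simp only [partialDeriv, heq.fderiv_eq]

theorem partialDeriv_add {F G : Euc d → ℝ} {y : Euc d} (hF : DifferentiableAt ℝ F y)
    (hG : DifferentiableAt ℝ G y) (i : Fin d) :
    partialDeriv i (fun z => F z + G z) y = partialDeriv i F y + partialDeriv i G y := by
  simp only [partialDeriv]
  rw [fderiv_fun_add hF hG]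
  rfl

theorem partialDeriv_mul {F G : Euc d → ℝ} {y : Euc d} (hF : DifferentiableAt ℝ F y)
    (hG : DifferentiableAt ℝ G y) (i : Fin d) :
    partialDeriv i (fun z => F z * G z) y
      = F y * partialDeriv i G y + partialDeriv i F y * G y := by
  simp only [partialDeriv]
  rw [fderiv_fun_mul hF hG]
  simp [mul_comm]

theorem partialDeriv_sum {ι : Type*} (u : Finset ι) {F : ι → Euc d → ℝ} {y : Euc d}
    (hF : ∀ a ∈ u, DifferentiableAt ℝ (F a) y) (i : Fin d) :
    partialDeriv i (fun z => ∑ a ∈ u, F a z) y = ∑ a ∈ u, partialDeriv i (F a) y := by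
  simp only [partialDeriv]
  rw [fderiv_fun_sum hF]
  simp

theorem covDeriv_contDiffOn {s : Set (Euc d)} (hs : IsOpen s)
    {Γ : Fin d → Fin d → Fin d → Euc d → ℝ} (hΓ : ∀ a i j, ContDiffOn ℝ ∞ (Γ a i j) s)
    {F : Euc d → ℝ} (k : ℕ) : ∀ (n : ℕ) (i : Fin k → Fin d),
    ContDiffOn ℝ ((n + k : ℕ) : ℕ∞ω) F s → ContDiffOn ℝ n (covDeriv Γ F k i) s := by
  induction k with
  | zero => intro n i hF; exact hF
  | succ k ih =>
    intro n i hF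
    have hF' : ContDiffOn ℝ ((n + 1 + k : ℕ) : ℕ∞ω) F s := by
      convert hF using 2
      omega
    refine ContDiffOn.sub ?_ (ContDiffOn.sum fun l _ => ContDiffOn.sum fun a _ => ?_)
    · exact partialDeriv_contDiffOn hs (ih (n + 1) (Fin.tail i) hF') (by norm_cast) _
    · refine ((hΓ _ _ _).of_le (by exact_mod_cast le_top)).mul ?_
      exact (ih (n + 1) _ hF').of_le (by norm_cast; omega)

/-- The operators that are, on `s`, finite combinations with smooth coefficients of the components
of the covariant derivatives of order at most `k`. -/
inductive LowerComb (s : Set (Euc d)) (Γ : Fin d → Fin d → Fin d → Euc d → ℝ) (k : ℕ) :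
    ((Euc d → ℝ) → Euc d → ℝ) → Prop
  | base (j : ℕ) (hj : j ≤ k) (m : Fin j → Fin d) :
      LowerComb s Γ k (fun F => covDeriv Γ F j m)
  | zero : LowerComb s Γ k (fun _ _ => 0)
  | add {A B : (Euc d → ℝ) → Euc d → ℝ} (hA : LowerComb s Γ k A)
      (hB : LowerComb s Γ k B) : LowerComb s Γ k (fun F y => A F y + B F y)
  | mul {A : (Euc d → ℝ) → Euc d → ℝ} (c : Euc d → ℝ) (hc : ContDiffOn ℝ ∞ c s)
      (hA : LowerComb s Γ k A) : LowerComb s Γ k (fun F y => c y * A F y)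
  | congr {A B : (Euc d → ℝ) → Euc d → ℝ} (hA : LowerComb s Γ k A)
      (h : ∀ F, ContDiffOn ℝ (k : ℕ∞ω) F s → ∀ y ∈ s, A F y = B F y) : LowerComb s Γ k B

namespace LowerComb

variable {s : Set (Euc d)} {Γ : Fin d → Fin d → Fin d → Euc d → ℝ}

theorem sum {k : ℕ} {ι : Type*} (u : Finset ι) {A : ι → (Euc d → ℝ) → Euc d → ℝ}
    (hA : ∀ a ∈ u, LowerComb s Γ k (A a)) : LowerComb s Γ k (fun F y => ∑ a ∈ u, A a F y) := by
  classical
  induction u using Finset.induction_on with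
  | empty => simpa using zero
  | insert a u ha ih =>
    simp only [Finset.sum_insert ha]
    exact (hA a (by simp)).add (ih fun b hb => hA b (by simp [hb]))

theorem mono {k k' : ℕ} (hk : k ≤ k') {A : (Euc d → ℝ) → Euc d → ℝ} (hA : LowerComb s Γ k A) :
    LowerComb s Γ k' A := by
  induction hA with
  | base j hj m => exact base j (hj.trans hk) m
  | zero => exact zero
  | add _ _ ihA ihB => exact ihA.add ihB
  | mul c hc _ ih => exact ih.mul c hc
  | congr _ h ih => exact ih.congr fun F hF => h F (hF.of_le (by exact_mod_cast hk))

theorem contDiffOn (hs : IsOpen s) (hΓ : ∀ a i j, ContDiffOn ℝ ∞ (Γ a i j) s) {k : ℕ}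
    {A : (Euc d → ℝ) → Euc d → ℝ} (hA : LowerComb s Γ k A) (n : ℕ) {F : Euc d → ℝ}
    (hF : ContDiffOn ℝ ((n + k : ℕ) : ℕ∞ω) F s) : ContDiffOn ℝ n (A F) s := by
  induction hA with
  | base j hj m =>
    exact covDeriv_contDiffOn hs hΓ j n m (hF.of_le (by exact_mod_cast Nat.add_le_add_left hj n))
  | zero => exact contDiffOn_const
  | add _ _ ihA ihB => exact ihA.add ihB
  | mul c hc _ ih => exact (hc.of_le (by exact_mod_cast le_top)).mul ih
  | congr _ h ih =>
    exact ih.congr fun y hy => (h F (hF.of_le (by exact_mod_cast Nat.le_add_left _ _)) y hy).symm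

theorem differentiableAt (hs : IsOpen s) (hΓ : ∀ a i j, ContDiffOn ℝ ∞ (Γ a i j) s) {k : ℕ}
    {A : (Euc d → ℝ) → Euc d → ℝ} (hA : LowerComb s Γ k A) {F : Euc d → ℝ}
    (hF : ContDiffOn ℝ ((k + 1 : ℕ) : ℕ∞ω) F s) {y : Euc d} (hy : y ∈ s) :
    DifferentiableAt ℝ (A F) y :=
  ((hA.contDiffOn hs hΓ 1 (by rwa [add_comm])).contDiffAt (hs.mem_nhds hy)).differentiableAt
    (by simp)

/-- The defining recursion of `covDeriv`, solved for the partial derivative, settles `base`; the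
product rule settles `mul`. Such identities need differentiability, hence the constructor `congr`,
which asks for agreement only on functions of class `Cᵏ` on `s`. -/
theorem partialDeriv (hs : IsOpen s) (hΓ : ∀ a i j, ContDiffOn ℝ ∞ (Γ a i j) s) {k : ℕ}
    {A : (Euc d → ℝ) → Euc d → ℝ} (hA : LowerComb s Γ k A) (i : Fin d) :
    LowerComb s Γ (k + 1) (fun F => Hestenes.partialDeriv i (A F)) := by
  induction hA with
  | base j hj m =>
    have h1 : LowerComb s Γ (k + 1) (fun F y => covDeriv Γ F (j + 1) (Fin.cons i m) y
        + ∑ l : Fin j, ∑ a : Fin d, Γ a i (m l) y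
            * covDeriv Γ F j (Function.update m l a) y) :=
      (base (j + 1) (by omega) _).add (sum _ fun l _ => sum _ fun a _ =>
        (base j (by omega) _).mul _ (hΓ _ _ _))
    refine h1.congr fun F _ y _ => ?_
    simp [covDeriv]
  | zero =>
    refine zero.congr fun F _ y _ => ?_
    simp [Hestenes.partialDeriv]
  | add hA hB ihA ihB =>
    refine (ihA.add ihB).congr fun F hF y hy => ?_
    exact (partialDeriv_add (hA.differentiableAt hs hΓ hF hy)
      (hB.differentiableAt hs hΓ hF hy) i).symm
  | mul c hc hA ih =>
    have h1 := (ih.mul c hc).add ((hA.mono (Nat.le_succ _)).mul _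
      (partialDeriv_contDiffOn hs hc (m := ∞) (by simp) i))
    refine h1.congr fun F hF y hy => ?_
    exact (partialDeriv_mul ((hc.contDiffAt (hs.mem_nhds hy)).differentiableAt (by simp))
      (hA.differentiableAt hs hΓ hF hy) i).symm
  | congr hA h ih =>
    refine ih.congr fun F hF y hy => ?_
    exact partialDeriv_congr_of_isOpen hs
      (h F (hF.of_le (by exact_mod_cast Nat.le_succ _))) hy i

/-- The covariant derivatives of `φ F` for one connection are combinations of those of `F` for
another one. -/
theorem covDeriv_mul (hs : IsOpen s) (hΓ : ∀ a i j, ContDiffOn ℝ ∞ (Γ a i j) s)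
    {Γ₁ : Fin d → Fin d → Fin d → Euc d → ℝ} (hΓ₁ : ∀ a i j, ContDiffOn ℝ ∞ (Γ₁ a i j) s)
    {φ : Euc d → ℝ} (hφ : ContDiffOn ℝ ∞ φ s) (k : ℕ) : ∀ i : Fin k → Fin d,
    LowerComb s Γ k (fun F => covDeriv Γ₁ (fun z => φ z * F z) k i) := by
  induction k with
  | zero => intro i; exact (base 0 le_rfl Fin.elim0).mul φ hφ
  | succ k ih =>
    intro i
    -- The recursion for `Γ₁`: its derivative term is re-expanded in covariant derivatives for `Γ`,
    -- and the symbols of `Γ₁` enter only as smooth coefficients of terms of order `k`.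
    have h1 := ((ih (Fin.tail i)).partialDeriv hs hΓ (i 0)).add
      ((sum Finset.univ fun l _ => sum Finset.univ fun a _ =>
        ((ih (Function.update (Fin.tail i) l a)).mono (Nat.le_succ k)).mul _
          (hΓ₁ a (i 0) (Fin.tail i l))).mul (fun _ => -1) contDiffOn_const)
    refine h1.congr fun F _ y _ => ?_
    simp only [covDeriv]
    ring

/-- Continuous coefficients are locally bounded. Both the constant and the neighbourhood are chosen
before `F`, which is what makes the later operator bounds uniform. -/
theorem eventually_le (hs : IsOpen s) {k : ℕ} {A : (Euc d → ℝ) → Euc d → ℝ}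
    (hA : LowerComb s Γ k A) {y₀ : Euc d} (hy₀ : y₀ ∈ s) :
    ∃ C : ℝ, 0 ≤ C ∧ ∀ᶠ y in 𝓝 y₀, ∀ F, ContDiffOn ℝ (k : ℕ∞ω) F s →
      |A F y| ≤ C * ∑ j ∈ Finset.range (k + 1), ∑ m : Fin j → Fin d, |covDeriv Γ F j m y| := by
  induction hA with
  | base j hj m =>
    refine ⟨1, zero_le_one, Filter.Eventually.of_forall fun y F _ => ?_⟩
    rw [one_mul]
    refine le_trans ?_ (Finset.single_le_sum (f := fun j => ∑ m : Fin j → Fin d,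
      |covDeriv Γ F j m y|) (fun j _ => Finset.sum_nonneg fun m _ => abs_nonneg _)
      (Finset.mem_range.2 (Nat.lt_succ_of_le hj)))
    exact Finset.single_le_sum (f := fun m => |covDeriv Γ F j m y|) (fun m _ => abs_nonneg _)
      (Finset.mem_univ m)
  | zero => exact ⟨0, le_rfl, Filter.Eventually.of_forall fun y F _ => by simp⟩
  | add _ _ ihA ihB =>
    obtain ⟨C, hC, h⟩ := ihA
    obtain ⟨C', hC', h'⟩ := ihB
    refine ⟨C + C', add_nonneg hC hC', ?_⟩
    filter_upwards [h, h'] with y hy hy' F hF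
    rw [add_mul]
    exact (abs_add_le _ _).trans (add_le_add (hy F hF) (hy' F hF))
  | mul c hc _ ih =>
    obtain ⟨C, hC, h⟩ := ih
    refine ⟨(|c y₀| + 1) * C, by positivity, ?_⟩
    have hcc : ContinuousAt (fun y => |c y|) y₀ :=
      (hc.continuousOn.continuousAt (hs.mem_nhds hy₀)).abs
    filter_upwards [h, hcc.eventually_lt_const (lt_add_one |c y₀|)] with y hy hy' F hF
    rw [abs_mul, mul_assoc]
    exact mul_le_mul hy'.le (hy F hF) (abs_nonneg _) (by positivity)
  | congr _ hAB ih =>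
    obtain ⟨C, hC, h⟩ := ih
    refine ⟨C, hC, ?_⟩
    filter_upwards [h, hs.mem_nhds hy₀] with y hy hys F hF
    rw [← hAB F hF y hys]
    exact hy F hF

end LowerComb

end Euclidean

/-! ### Transformation of covariant derivatives under a change of coordinates. -/

section TensorLaw

variable {d : ℕ}

theorem partialDeriv_comp {ψ : Euc d → Euc d} {F : Euc d → ℝ} {y : Euc d}
    (hψ : DifferentiableAt ℝ ψ y) (hF : DifferentiableAt ℝ F (ψ y)) (i : Fin d) :
    partialDeriv i (fun z => F (ψ z)) y
      = ∑ p, partialDeriv i (fun z => ψ z p) y * partialDeriv p F (ψ y) := by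
  have h1 : fderiv ℝ (fun z => F (ψ z)) y = (fderiv ℝ F (ψ y)).comp (fderiv ℝ ψ y) :=
    fderiv_comp y hF hψ
  have h2 : ∀ p, partialDeriv i (fun z => ψ z p) y = fderiv ℝ ψ y (basisVec i) p := by
    intro p
    have h3 : HasFDerivAt (fun z => ψ z p)
        ((EuclideanSpace.proj p : Euc d →L[ℝ] ℝ).comp (fderiv ℝ ψ y)) y :=
      (EuclideanSpace.proj p : Euc d →L[ℝ] ℝ).hasFDerivAt.comp y hψ.hasFDerivAt
    rw [partialDeriv, h3.fderiv]
    rfl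
  have h3 : ∀ v : Euc d, v = ∑ p, v p • basisVec p := by
    intro v
    ext q
    simp [basisVec, Pi.single_apply]
  rw [partialDeriv, h1]
  conv_lhs => rw [ContinuousLinearMap.comp_apply, h3 (fderiv ℝ ψ y (basisVec i))]
  simp only [map_sum, map_smul, smul_eq_mul, h2]
  rfl

theorem partialDeriv_prod {ι : Type*} [DecidableEq ι] (u : Finset ι) {F : ι → Euc d → ℝ}
    {y : Euc d} (hF : ∀ a ∈ u, DifferentiableAt ℝ (F a) y) (i : Fin d) :
    partialDeriv i (fun z => ∏ a ∈ u, F a z) y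
      = ∑ a ∈ u, partialDeriv i (F a) y * ∏ b ∈ u.erase a, F b y := by
  simp only [partialDeriv]
  rw [fderiv_finsetProd hF]
  simp [mul_comm]

theorem prod_update_left {k : ℕ} (J : Fin d → Fin d → ℝ) (i p : Fin k → Fin d) (l : Fin k)
    (a : Fin d) : ∏ m, J (Function.update i l a m) (p m)
      = J a (p l) * ∏ m ∈ Finset.univ.erase l, J (i m) (p m) := by
  rw [← Finset.mul_prod_erase _ _ (Finset.mem_univ l), Function.update_self]
  congr 1
  refine Finset.prod_congr rfl fun m hm => ?_
  rw [Function.update_of_ne (Finset.ne_of_mem_erase hm)]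

/-- Exchanging `a` with the `l`-th entry of `p` is an involution of the index pairs. -/
theorem sum_update_swap {k : ℕ} (l : Fin k) (X : (Fin k → Fin d) → Fin d → ℝ) :
    ∑ p : Fin k → Fin d, ∑ a, X (Function.update p l a) (p l) = ∑ p, ∑ a, X p a := by
  rw [← Fintype.sum_prod_type', ← Fintype.sum_prod_type']
  refine Fintype.sum_equiv
    (Function.Involutive.toPerm (fun x : (Fin k → Fin d) × Fin d =>
      (Function.update x.1 l x.2, x.1 l)) ?_) _ _ fun x => rfl
  rintro ⟨p, a⟩
  simp

/-- The contribution of slot `l` to the tensor law. Here `J` is the Jacobian, `DJ` its derivative in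
the new direction `i₀`, `r` the row of `J` in that direction, and `G`, `G'` hold the two families of
symbols. By `h`, the second derivatives absorb the old symbols and leave exactly the new ones. -/
theorem tensor_slot_identity {k : ℕ} (i : Fin k → Fin d) (J DJ G : Fin d → Fin d → ℝ)
    (r : Fin d → ℝ) (G' : Fin d → Fin d → Fin d → ℝ)
    (h : ∀ j c, DJ j c = ∑ a, G a j * J a c - ∑ q, ∑ b, r q * J j b * G' c q b)
    (T : (Fin k → Fin d) → ℝ) (l : Fin k) :
    ∑ p : Fin k → Fin d, (DJ (i l) (p l) * ∏ m ∈ Finset.univ.erase l, J (i m) (p m)) * T p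
      - ∑ a, G a (i l) * ∑ p : Fin k → Fin d, (∏ m, J (Function.update i l a m) (p m)) * T p
    = - ∑ q, ∑ p : Fin k → Fin d, (r q * ∏ m, J (i m) (p m)) *
        ∑ a, G' a q (p l) * T (Function.update p l a) := by
  have hP : ∀ (p : Fin k → Fin d) (a : Fin d),
      ∏ m ∈ Finset.univ.erase l, J (i m) (Function.update p l a m)
        = ∏ m ∈ Finset.univ.erase l, J (i m) (p m) := fun p a =>
    Finset.prod_congr rfl fun m hm => by
      rw [Function.update_of_ne (Finset.ne_of_mem_erase hm)]
  -- After swapping the updated entry with the summation index, every term carries `T p`, so both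
  -- sides can be compared for fixed `p`.
  have hR : ∀ q, ∑ p : Fin k → Fin d, (r q * ∏ m, J (i m) (p m)) *
        ∑ a, G' a q (p l) * T (Function.update p l a)
      = ∑ p : Fin k → Fin d, ∑ b, r q * J (i l) b * G' (p l) q b *
          (∏ m ∈ Finset.univ.erase l, J (i m) (p m)) * T p := by
    intro q
    rw [← sum_update_swap l]
    refine Finset.sum_congr rfl fun p _ => ?_
    rw [Finset.mul_sum]
    refine Finset.sum_congr rfl fun a _ => ?_
    rw [hP, Function.update_self, ← Finset.mul_prod_erase _ _ (Finset.mem_univ l)]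
    ring
  simp only [hR, prod_update_left]
  rw [Finset.sum_comm (s := Finset.univ (α := Fin d))]
  simp only [Finset.mul_sum]
  rw [Finset.sum_comm (s := Finset.univ (α := Fin d)), ← Finset.sum_sub_distrib,
    ← Finset.sum_neg_distrib]
  refine Finset.sum_congr rfl fun p _ => ?_
  rw [h]
  simp only [sub_mul, Finset.sum_mul]
  rw [sub_sub, sub_eq_iff_eq_add, ← sub_eq_iff_eq_add']
  rw [sub_eq_iff_eq_add]
  have e1 : ∀ a, G a (i l) * J a (p l) * (∏ m ∈ Finset.univ.erase l, J (i m) (p m)) * T p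
      = G a (i l) * (J a (p l) * (∏ m ∈ Finset.univ.erase l, J (i m) (p m)) * T p) :=
    fun a => by ring
  simp only [e1]
  ring

/-- The transformation law of covariant derivatives under a change of coordinates `ψ`, for
connections whose symbols are related by the transformation law of Christoffel symbols. -/
theorem covDeriv_comp {s t : Set (Euc d)} (hs : IsOpen s) (ht : IsOpen t) {ψ : Euc d → Euc d}
    (hψ : ContDiffOn ℝ ∞ ψ s) (hst : Set.MapsTo ψ s t)
    {Γ Γ' : Fin d → Fin d → Fin d → Euc d → ℝ} (hΓ' : ∀ a i j, ContDiffOn ℝ ∞ (Γ' a i j) t)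
    (hΓ : ∀ y ∈ s, ∀ i j c, partialDeriv i (partialDeriv j (fun z => ψ z c)) y
      = ∑ a, Γ a i j y * partialDeriv a (fun z => ψ z c) y
        - ∑ q, ∑ b, partialDeriv i (fun z => ψ z q) y * partialDeriv j (fun z => ψ z b) y
          * Γ' c q b (ψ y))
    {F : Euc d → ℝ} (k : ℕ) (hF : ContDiffOn ℝ (k : ℕ∞ω) F t) : ∀ (i : Fin k → Fin d), ∀ y ∈ s,
    covDeriv Γ (fun z => F (ψ z)) k i y
      = ∑ p : Fin k → Fin d, (∏ l, partialDeriv (i l) (fun z => ψ z (p l)) y)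
          * covDeriv Γ' F k p (ψ y) := by
  induction k with
  | zero => intro i y hy; simp [covDeriv]
  | succ k ih =>
    intro i y hy
    have ih' := ih (hF.of_le (by exact_mod_cast Nat.le_succ k))
    have hcomp : ∀ c, ContDiffOn ℝ ∞ (fun z => ψ z c) s := fun c =>
      (EuclideanSpace.proj c : Euc d →L[ℝ] ℝ).contDiff.comp_contDiffOn hψ
    have hJ : ∀ j c, DifferentiableAt ℝ (partialDeriv j (fun z => ψ z c)) y := fun j c =>
      ((partialDeriv_contDiffOn hs (hcomp c) (m := ∞) (by simp) j).contDiffAt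
        (hs.mem_nhds hy)).differentiableAt (by simp)
    have hψy : DifferentiableAt ℝ ψ y :=
      (hψ.contDiffAt (hs.mem_nhds hy)).differentiableAt (by simp)
    have hT : ∀ p, DifferentiableAt ℝ (covDeriv Γ' F k p) (ψ y) := fun p =>
      ((covDeriv_contDiffOn ht hΓ' k 1 p (by rwa [add_comm])).contDiffAt
        (ht.mem_nhds (hst hy))).differentiableAt (by simp)
    have hTψ : ∀ p, DifferentiableAt ℝ (fun z => covDeriv Γ' F k p (ψ z)) y := fun p =>
      (hT p).comp y hψy
    have hprod : ∀ p : Fin k → Fin d, DifferentiableAt ℝ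
        (fun z => ∏ l, partialDeriv (Fin.tail i l) (fun z => ψ z (p l)) z) y := fun p =>
      (HasFDerivAt.finsetProd fun l _ => (hJ _ _).hasFDerivAt).differentiableAt
    -- Leibniz rule on the inductive formula: the derivative falls either on the tensor component,
    -- giving the chain rule sum, or on one of the Jacobian factors.
    have hfirst : partialDeriv (i 0) (fun z => covDeriv Γ (fun z => F (ψ z)) k (Fin.tail i) z) y
        = ∑ p : Fin k → Fin d,
          ((∏ l, partialDeriv (Fin.tail i l) (fun z => ψ z (p l)) y)
            * ∑ q, partialDeriv (i 0) (fun z => ψ z q) y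
                * partialDeriv q (covDeriv Γ' F k p) (ψ y)
          + (∑ l, partialDeriv (i 0) (partialDeriv (Fin.tail i l) (fun z => ψ z (p l))) y
            * ∏ m ∈ Finset.univ.erase l, partialDeriv (Fin.tail i m) (fun z => ψ z (p m)) y)
            * covDeriv Γ' F k p (ψ y)) := by
      rw [partialDeriv_congr_of_isOpen hs (ih' (Fin.tail i)) hy,
        partialDeriv_sum _ fun p _ => (hprod p).fun_mul (hTψ p)]
      refine Finset.sum_congr rfl fun p _ => ?_
      rw [partialDeriv_mul (hprod p) (hTψ p), partialDeriv_comp hψy (hT p),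
        partialDeriv_prod _ fun l _ => hJ _ _]
    have hslot := fun l : Fin k => tensor_slot_identity (Fin.tail i)
      (fun j c => partialDeriv j (fun z => ψ z c) y)
      (fun j c => partialDeriv (i 0) (partialDeriv j (fun z => ψ z c)) y)
      (fun a j => Γ a (i 0) j y) (fun q => partialDeriv (i 0) (fun z => ψ z q) y)
      (fun a q b => Γ' a q b (ψ y)) (fun j c => hΓ y hy (i 0) j c)
      (fun p => covDeriv Γ' F k p (ψ y)) l
    have hslots := Finset.sum_congr (s₁ := Finset.univ) rfl fun l (_ : l ∈ Finset.univ) => hslot l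
    rw [Finset.sum_sub_distrib] at hslots
    rw [covDeriv, hfirst]
    simp only [ih' _ y hy]
    rw [Finset.sum_add_distrib, add_sub_assoc]
    simp only [Finset.sum_mul (s := Finset.univ (α := Fin k))]
    rw [Finset.sum_comm (s := Finset.univ (α := Fin k → Fin d)) (t := Finset.univ (α := Fin k)),
      hslots]
    -- A multi-index of length `k + 1` is split into its head `q`, the direction of differentiation,
    -- and its tail `p`; the derivative terms and the Christoffel terms then match separately.
    rw [← Fintype.sum_equiv (Fin.consEquiv fun _ : Fin (k + 1) => Fin d) _ _ fun x => rfl,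
      Fintype.sum_prod_type]
    simp only [Fin.consEquiv_apply, Fin.prod_univ_succ, Fin.cons_zero, Fin.cons_succ, covDeriv,
      mul_sub, Finset.sum_sub_distrib]
    rw [sub_eq_add_neg]
    congr 1
    · rw [Finset.sum_comm]
      refine Finset.sum_congr rfl fun p _ => ?_
      rw [Finset.mul_sum]
      refine Finset.sum_congr rfl fun q _ => ?_
      rw [show Fin.tail ((Fin.consEquiv fun _ : Fin (k + 1) => Fin d) (q, p)) = p from rfl]
      simp only [Fin.tail]
      ring
    · rw [Finset.sum_neg_distrib]
      congr 1
      rw [Finset.sum_comm]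
      refine Finset.sum_congr rfl fun q _ => ?_
      rw [Finset.sum_comm]
      refine Finset.sum_congr rfl fun p _ => ?_
      rw [Finset.mul_sum]
      rfl

end TensorLaw

/-! ### Gram matrices and Christoffel symbols under a change of chart. -/

section ChartChange

variable {d : ℕ}

/-- The uniqueness argument for the Levi-Civita connection, as algebra at one point. `hdG` is the
derivative of `G = J G' Jᵀ`, and `hDJ` is the symmetry of second derivatives. In the Koszul
combination of `dG` this symmetry leaves only `2 S k i j` and the terms with `dG'`. The law
therefore holds after lowering its index with `G'` and `J`, and these matrices are invertible. -/
theorem christoffel_law_of_metric {J G' : Matrix (Fin d) (Fin d) ℝ} (hJ : J.det ≠ 0)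
    (hG' : G'.det ≠ 0) (hsymm : ∀ p q, G' p q = G' q p)
    {DJ dG dG' Γ Γ' : Fin d → Fin d → Fin d → ℝ} (hDJ : ∀ k i p, DJ k i p = DJ i k p)
    (hdG : ∀ k i j, dG k i j = ∑ p, ∑ q, (DJ k i p * J j q * G' p q + J i p * DJ k j q * G' p q
      + J i p * J j q * ∑ r, J k r * dG' r p q))
    (hΓ : ∀ k i j, ∑ a, Γ a k i * (∑ p, ∑ q, J a p * J j q * G' p q)
      = (1 / 2 : ℝ) * (dG k i j + dG i k j - dG j k i))
    (hΓ' : ∀ r p q, ∑ c, Γ' c r p * G' c q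
      = (1 / 2 : ℝ) * (dG' r p q + dG' p r q - dG' q r p)) (k i c : Fin d) :
    DJ k i c = ∑ a, Γ a k i * J a c - ∑ q, ∑ b, J k q * J i b * Γ' c q b := by
  let S : Fin d → Fin d → Fin d → ℝ := fun k i j => ∑ p, ∑ q, DJ k i p * J j q * G' p q
  let R : Fin d → Fin d → Fin d → ℝ := fun k i j =>
    ∑ q, ∑ r, ∑ p, J k r * J i p * J j q * dG' r p q
  have hS : ∀ k i j, S k i j = S i k j := fun k i j => by simp only [S, hDJ k i]
  have hdG2 : ∀ k i j, dG k i j = S k i j + S k j i + R k i j := by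
    intro k i j
    rw [hdG]
    simp only [Finset.sum_add_distrib]
    congr 1
    · congr 1
      rw [Finset.sum_comm]
      refine Finset.sum_congr rfl fun q _ => Finset.sum_congr rfl fun p _ => ?_
      rw [hsymm]
      ring
    · rw [Finset.sum_comm]
      refine Finset.sum_congr rfl fun q _ => ?_
      rw [Finset.sum_comm]
      simp only [Finset.mul_sum]
      rw [Finset.sum_comm]
      conv_rhs => rw [Finset.sum_comm]
      refine Finset.sum_congr rfl fun p _ => ?_
      exact Finset.sum_congr rfl fun r _ => by ring
  -- The defect of the claimed law, lowered by `G'` and `J`. Its three parts are computed in `hA`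
  -- (old symbols), `hB` (new symbols) and `hC` (second derivatives).
  have hX : J.mulVec (Matrix.vecMul (fun c => ∑ a, Γ a k i * J a c
      - ∑ q, ∑ b, J k q * J i b * Γ' c q b - DJ k i c) G') = 0 := by
    ext j
    have hA : ∑ q, J j q * ∑ c, (∑ a, Γ a k i * J a c) * G' c q
        = (1 / 2 : ℝ) * (dG k i j + dG i k j - dG j k i) := by
      rw [← hΓ]
      simp only [Finset.mul_sum, Finset.sum_mul]
      rw [Finset.sum_comm]
      conv_lhs => enter [2, c]; rw [Finset.sum_comm]
      rw [Finset.sum_comm]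
      exact Finset.sum_congr rfl fun a _ => Finset.sum_congr rfl fun p _ =>
        Finset.sum_congr rfl fun q _ => by ring
    have hC : ∑ q, J j q * ∑ c, DJ k i c * G' c q = S k i j := by
      simp only [S, Finset.mul_sum]
      rw [Finset.sum_comm]
      exact Finset.sum_congr rfl fun p _ => Finset.sum_congr rfl fun q _ => by ring
    have hB : ∑ q, J j q * ∑ c, (∑ r, ∑ b, J k r * J i b * Γ' c r b) * G' c q
        = (1 / 2 : ℝ) * (R k i j + R i k j - R j k i) := by
      have h1 : ∀ q, ∑ c, (∑ r, ∑ b, J k r * J i b * Γ' c r b) * G' c q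
          = ∑ r, ∑ b, J k r * J i b * ((1 / 2 : ℝ) * (dG' r b q + dG' b r q - dG' q r b)) := by
        intro q
        simp only [← hΓ', Finset.mul_sum, Finset.sum_mul]
        rw [Finset.sum_comm]
        refine Finset.sum_congr rfl fun r _ => ?_
        rw [Finset.sum_comm]
        exact Finset.sum_congr rfl fun p _ => Finset.sum_congr rfl fun q _ => by ring
      have h2 : R i k j = ∑ q, ∑ r, ∑ p, J k r * J i p * J j q * dG' p r q := by
        refine Finset.sum_congr rfl fun q _ => ?_
        rw [Finset.sum_comm]
        exact Finset.sum_congr rfl fun p _ => Finset.sum_congr rfl fun r _ => by ring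
      have h3 : R j k i = ∑ q, ∑ r, ∑ p, J k r * J i p * J j q * dG' q r p := by
        simp only [R]
        rw [Finset.sum_comm]
        refine Finset.sum_congr rfl fun q _ => ?_
        rw [Finset.sum_comm]
        exact Finset.sum_congr rfl fun p _ => Finset.sum_congr rfl fun r _ => by ring
      rw [h2, h3]
      simp only [h1, R, ← Finset.sum_add_distrib, ← Finset.sum_sub_distrib, Finset.mul_sum]
      exact Finset.sum_congr rfl fun q _ => Finset.sum_congr rfl fun r _ =>
        Finset.sum_congr rfl fun p _ => by ring
    have hexp : J.mulVec (Matrix.vecMul (fun c => ∑ a, Γ a k i * J a c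
        - ∑ q, ∑ b, J k q * J i b * Γ' c q b - DJ k i c) G') j
        = ∑ q, J j q * ∑ c, (∑ a, Γ a k i * J a c) * G' c q
          - ∑ q, J j q * ∑ c, (∑ r, ∑ b, J k r * J i b * Γ' c r b) * G' c q
          - ∑ q, J j q * ∑ c, DJ k i c * G' c q := by
      simp only [Matrix.mulVec, Matrix.vecMul, dotProduct, sub_mul, Finset.sum_sub_distrib,
        mul_sub]
    rw [hexp, hA, hB, hC, hdG2, hdG2, hdG2, Pi.zero_apply, hS i k j, hS j k i, hS j i k]
    ring
  have h0 := congrFun (Matrix.eq_zero_of_vecMul_eq_zero hG'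
    (Matrix.eq_zero_of_mulVec_eq_zero hJ hX)) c
  simp only [Pi.zero_apply] at h0
  linarith

/-- Contracting with `gram` cancels the inverse Gram matrix and leaves the Koszul formula, the form
that `christoffel_law_of_metric` requires. -/
theorem christoffel_lower {M : Type*} [TopologicalSpace M] [ChartedSpace (Euc d) M]
    [IsManifold 𝓘(ℝ, Euc d) ∞ M] (g : RiemMetric d M) {e : OpenPartialHomeomorph M (Euc d)}
    (he : e ∈ smoothCharts d M) {y : Euc d} (hy : y ∈ e.target) (k i j : Fin d) :
    ∑ a, christoffel g e a k i y * gram g e y a j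
      = (1 / 2 : ℝ) * (partialDeriv k (fun z => gram g e z i j) y
        + partialDeriv i (fun z => gram g e z k j) y
        - partialDeriv j (fun z => gram g e z k i) y) := by
  have hdet : IsUnit (gram g e y).det := (gram_posDef g he hy).det_pos.ne'.isUnit
  have hinv : ∀ m, ∑ a, (gram g e y)⁻¹ a m * gram g e y a j = if m = j then 1 else 0 := by
    intro m
    have h := congrFun (congrFun (Matrix.mul_nonsing_inv _ hdet) j) m
    rw [Matrix.mul_apply, Matrix.one_apply] at h
    simp only [eq_comm (a := m)]
    rw [← h]
    refine Finset.sum_congr rfl fun a _ => ?_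
    rw [gram_symm g e y a j]
    ring
  simp only [christoffel, Finset.mul_sum, Finset.sum_mul]
  rw [Finset.sum_comm]
  have : ∀ m, ∑ a, (1 / 2 : ℝ) * ((gram g e y)⁻¹ a m *
      (partialDeriv k (fun z => gram g e z i m) y + partialDeriv i (fun z => gram g e z k m) y
        - partialDeriv m (fun z => gram g e z k i) y)) * gram g e y a j
      = (1 / 2 : ℝ) * (partialDeriv k (fun z => gram g e z i m) y
        + partialDeriv i (fun z => gram g e z k m) y
        - partialDeriv m (fun z => gram g e z k i) y) * (if m = j then 1 else 0) := by
    intro m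
    rw [← hinv m, Finset.mul_sum]
    refine Finset.sum_congr rfl fun a _ => ?_
    ring
  simp only [this, mul_ite, mul_one, mul_zero, Finset.sum_ite_eq', Finset.mem_univ, if_true]

theorem natCast_le_infty (n : ℕ) : (n : ℕ∞ω) ≤ (∞ : ℕ∞ω) := by exact_mod_cast le_top

theorem partialDeriv_comm {F : Euc d → ℝ} {y : Euc d} (hF : ContDiffAt ℝ ∞ F y) (i j : Fin d) :
    partialDeriv i (partialDeriv j F) y = partialDeriv j (partialDeriv i F) y := by
  have hd : DifferentiableAt ℝ (fderiv ℝ F) y :=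
    (hF.fderiv_right (m := 1) (natCast_le_infty 2)).differentiableAt (by simp)
  have h : ∀ i j : Fin d, partialDeriv i (partialDeriv j F) y
      = fderiv ℝ (fderiv ℝ F) y (basisVec i) (basisVec j) := by
    intro i j
    change fderiv ℝ (fun z => fderiv ℝ F z (basisVec j)) y (basisVec i) = _
    rw [fderiv_clm_apply hd (differentiableAt_const _)]
    simp
  rw [h, h]
  exact hF.isSymmSndFDerivAt (by simpa using natCast_le_infty 2) _ _

variable {M : Type*} [TopologicalSpace M] [ChartedSpace (Euc d) M]

/-- The Jacobian matrix at `y` of the change of coordinates from `e` to `e'`: the entry `i p` is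
the `i`-th partial derivative of the `p`-th new coordinate. -/
def jacobian (e e' : OpenPartialHomeomorph M (Euc d)) (y : Euc d) : Matrix (Fin d) (Fin d) ℝ :=
  Matrix.of fun i p => partialDeriv i (fun z => e' (e.symm z) p) y

variable {e e' : OpenPartialHomeomorph M (Euc d)}

theorem transition_contDiffOn (he : e ∈ smoothCharts d M) (he' : e' ∈ smoothCharts d M) :
    ContDiffOn ℝ ∞ (fun y => e' (e.symm y)) (e.symm ≫ₕ e').source := by
  have h := (contMDiffOn_of_mem_maximalAtlas he').comp
    ((contMDiffOn_symm_of_mem_maximalAtlas he).mono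
      (t := (e.symm ≫ₕ e').source) fun y hy => hy.1)
    fun y hy => hy.2
  exact contMDiffOn_iff_contDiffOn.1 h

variable [IsManifold 𝓘(ℝ, Euc d) ∞ M]

/-- Chain rule for `e.symm = e'.symm ∘ (e' ∘ e.symm)` near `y`. The two sides sit over base points
that are only propositionally equal, so tangent vectors are read in the model space `Euc d`. -/
theorem coordVec_transition (he : e ∈ smoothCharts d M) (he' : e' ∈ smoothCharts d M)
    {y : Euc d} (hy : y ∈ (e.symm ≫ₕ e').source) (i : Fin d) :
    (coordVec e i y : Euc d)
      = ∑ p, jacobian e e' y i p • (coordVec e' p (e' (e.symm y)) : Euc d) := by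
  have hψ : DifferentiableAt ℝ (fun y => e' (e.symm y)) y :=
    ((transition_contDiffOn he he').contDiffAt
      ((e.symm ≫ₕ e').open_source.mem_nhds hy)).differentiableAt (by simp)
  have heq : (e.symm : Euc d → M) =ᶠ[𝓝 y] (e'.symm ∘ fun y => e' (e.symm y)) := by
    filter_upwards [(e.symm ≫ₕ e').open_source.mem_nhds hy] with z hz
    exact (e'.left_inv hz.2).symm
  have hd : MDifferentiableAt 𝓘(ℝ, Euc d) 𝓘(ℝ, Euc d) e'.symm (e' (e.symm y)) :=
    ((contMDiffOn_symm_of_mem_maximalAtlas he').mdifferentiableOn (by simp)).mdifferentiableAt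
      (e'.open_target.mem_nhds (e'.map_source hy.2))
  have h1 : coordVec e i y = (mfderiv 𝓘(ℝ, Euc d) 𝓘(ℝ, Euc d) e'.symm (e' (e.symm y)) :
      Euc d →L[ℝ] Euc d) (fderiv ℝ (fun y => e' (e.symm y)) y (basisVec i)) := by
    have h2 : (mfderiv 𝓘(ℝ, Euc d) 𝓘(ℝ, Euc d) e.symm y : Euc d →L[ℝ] Euc d)
        = mfderiv 𝓘(ℝ, Euc d) 𝓘(ℝ, Euc d) (e'.symm ∘ fun y => e' (e.symm y)) y :=
      heq.mfderiv_eq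
    have h3 := mfderiv_comp y hd hψ.mdifferentiableAt
    rw [mfderiv_eq_fderiv] at h3
    have h4 := h2.trans h3
    exact congrArg (fun L : Euc d →L[ℝ] Euc d => L (basisVec i)) h4
  have h5 : fderiv ℝ (fun y => e' (e.symm y)) y (basisVec i)
      = ∑ p, jacobian e e' y i p • basisVec p := by
    ext p
    have h6 := (EuclideanSpace.proj p : Euc d →L[ℝ] ℝ).hasFDerivAt.comp y hψ.hasFDerivAt
    have h7 : jacobian e e' y i p = fderiv ℝ (fun y => e' (e.symm y)) y (basisVec i) p := by
      change fderiv ℝ ((EuclideanSpace.proj p : Euc d →L[ℝ] ℝ) ∘ fun y => e' (e.symm y)) y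
        (basisVec i) = _
      rw [h6.fderiv]
      rfl
    rw [← h7]
    simp [basisVec, Pi.single_apply]
  have hL : ∀ L : Euc d →L[ℝ] Euc d, L (∑ p, jacobian e e' y i p • basisVec p)
      = ∑ p, jacobian e e' y i p • L (basisVec p) := fun L => by simp only [map_sum, map_smul]
  rw [h1, h5]
  exact hL _

theorem gram_transition (g : RiemMetric d M) (he : e ∈ smoothCharts d M)
    (he' : e' ∈ smoothCharts d M) {y : Euc d} (hy : y ∈ (e.symm ≫ₕ e').source) (i j : Fin d) :
    gram g e y i j = ∑ p, ∑ q, jacobian e e' y i p * jacobian e e' y j q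
      * gram g e' (e' (e.symm y)) p q := by
  -- The metric with values in a fixed space, so that its base point can be rewritten.
  let B : M → Euc d →L[ℝ] Euc d →L[ℝ] ℝ := fun x => g.inner x
  have h1 : gram g e y i j = B (e.symm y) (coordVec e i y) (coordVec e j y) := rfl
  have h2 : ∀ p q, gram g e' (e' (e.symm y)) p q = B (e'.symm (e' (e.symm y)))
    (coordVec e' p (e' (e.symm y))) (coordVec e' q (e' (e.symm y))) := fun p q => rfl
  rw [show e'.symm (e' (e.symm y)) = e.symm y from e'.left_inv hy.2] at h2
  rw [h1, coordVec_transition he he' hy i, coordVec_transition he he' hy j]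
  have hB : ∀ (b : Euc d →L[ℝ] Euc d →L[ℝ] ℝ) (u : Fin d → Euc d) (v w : Fin d → ℝ),
      b (∑ p, v p • u p) (∑ q, w q • u q) = ∑ p, ∑ q, v p * w q * b (u p) (u q) := by
    intro b u v w
    simp only [map_sum, map_smul, _root_.sum_apply, _root_.smul_apply, smul_eq_mul,
      Finset.mul_sum]
    rw [Finset.sum_comm]
    exact Finset.sum_congr rfl fun p _ => Finset.sum_congr rfl fun q _ => by ring
  refine (hB _ _ _ _).trans ?_
  exact Finset.sum_congr rfl fun p _ => Finset.sum_congr rfl fun q _ => by rw [h2]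

theorem gram_transition_matrix (g : RiemMetric d M) (he : e ∈ smoothCharts d M)
    (he' : e' ∈ smoothCharts d M) {y : Euc d} (hy : y ∈ (e.symm ≫ₕ e').source) :
    gram g e y = jacobian e e' y * gram g e' (e' (e.symm y)) * (jacobian e e' y).transpose := by
  ext i j
  rw [gram_transition g he he' hy]
  simp only [Matrix.mul_apply, Matrix.transpose_apply, Finset.sum_mul]
  rw [Finset.sum_comm]
  exact Finset.sum_congr rfl fun p _ => Finset.sum_congr rfl fun q _ => by ring

/-- The metric gives this directly: `det G = (det J)² det G'`, and `det G` is positive. -/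
theorem jacobian_det_ne_zero (g : RiemMetric d M) (he : e ∈ smoothCharts d M)
    (he' : e' ∈ smoothCharts d M) {y : Euc d} (hy : y ∈ (e.symm ≫ₕ e').source) :
    (jacobian e e' y).det ≠ 0 := by
  intro h0
  have h1 := (gram_posDef g he hy.1).det_pos
  rw [gram_transition_matrix g he he' hy, Matrix.det_mul, Matrix.det_mul, h0] at h1
  simp at h1

theorem christoffel_transition (g : RiemMetric d M) (he : e ∈ smoothCharts d M)
    (he' : e' ∈ smoothCharts d M) {y : Euc d} (hy : y ∈ (e.symm ≫ₕ e').source) (i j c : Fin d) :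
    partialDeriv i (partialDeriv j (fun z => e' (e.symm z) c)) y
      = ∑ a, christoffel g e a i j y * partialDeriv a (fun z => e' (e.symm z) c) y
        - ∑ q, ∑ b, partialDeriv i (fun z => e' (e.symm z) q) y
          * partialDeriv j (fun z => e' (e.symm z) b) y
          * christoffel g e' c q b (e' (e.symm y)) := by
  have hs := (e.symm ≫ₕ e').open_source
  have hψ := transition_contDiffOn he he'
  have hψy : DifferentiableAt ℝ (fun y => e' (e.symm y)) y :=
    (hψ.contDiffAt (hs.mem_nhds hy)).differentiableAt (by simp)
  have hcomp : ∀ c, ContDiffOn ℝ ∞ (fun z => e' (e.symm z) c) (e.symm ≫ₕ e').source := fun c =>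
    (EuclideanSpace.proj c : Euc d →L[ℝ] ℝ).contDiff.comp_contDiffOn hψ
  have hJ : ∀ j c, DifferentiableAt ℝ (fun z => jacobian e e' z j c) y := fun j c =>
    ((partialDeriv_contDiffOn hs (hcomp c) (m := ∞) (by simp) j).contDiffAt
      (hs.mem_nhds hy)).differentiableAt (by simp)
  have hy' : e' (e.symm y) ∈ e'.target := e'.map_source hy.2
  have hG : ∀ p q, DifferentiableAt ℝ (fun z => gram g e' z p q) (e' (e.symm y)) := fun p q =>
    ((gram_contDiffOn g he' p q).contDiffAt (e'.open_target.mem_nhds hy')).differentiableAt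
      (by simp)
  have hGψ : ∀ p q, DifferentiableAt ℝ (fun z => gram g e' (e' (e.symm z)) p q) y := fun p q =>
    (hG p q).comp (f := fun z => e' (e.symm z)) y hψy
  refine christoffel_law_of_metric (J := jacobian e e' y) (G' := gram g e' (e' (e.symm y)))
    (DJ := fun i j c => partialDeriv i (fun z => jacobian e e' z j c) y)
    (dG := fun k i j => partialDeriv k (fun z => gram g e z i j) y)
    (dG' := fun r p q => partialDeriv r (fun z => gram g e' z p q) (e' (e.symm y)))
    (Γ := fun a i j => christoffel g e a i j y)
    (Γ' := fun a i j => christoffel g e' a i j (e' (e.symm y)))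
    (jacobian_det_ne_zero g he he' hy) (gram_posDef g he' hy').det_pos.ne' (gram_symm g e' _)
    (fun k i p => partialDeriv_comm ((hcomp p).contDiffAt (hs.mem_nhds hy)) k i) ?_ ?_
    (fun r p q => christoffel_lower g he' hy' r p q) i j c
  · intro k i j
    rw [partialDeriv_congr_of_isOpen hs (fun z hz => gram_transition g he he' hz i j) hy,
      partialDeriv_sum _ fun p _ => DifferentiableAt.fun_sum fun q _ =>
        ((hJ i p).fun_mul (hJ j q)).fun_mul (hGψ p q)]
    refine Finset.sum_congr rfl fun p _ => ?_
    rw [partialDeriv_sum _ fun q _ => ((hJ i p).fun_mul (hJ j q)).fun_mul (hGψ p q)]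
    refine Finset.sum_congr rfl fun q _ => ?_
    rw [partialDeriv_mul ((hJ i p).fun_mul (hJ j q)) (hGψ p q), partialDeriv_mul (hJ i p) (hJ j q),
      partialDeriv_comp (F := fun z => gram g e' z p q) hψy (hG p q)]
    simp only [jacobian, Matrix.of_apply]
    ring
  · intro k i j
    simp only [← gram_transition g he he' hy]
    exact christoffel_lower g he hy.1 k i j

end ChartChange

/-! ### Norms on `k`-tensors: pullback and comparison with components. -/

section TensorNorm

variable {d : ℕ}

theorem sum_comm_pairs {ι κ : Type*} [Fintype ι] [Fintype κ] (X : ι → ι → κ → κ → ℝ) :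
    ∑ i, ∑ j, ∑ p, ∑ q, X i j p q = ∑ p, ∑ q, ∑ i, ∑ j, X i j p q := by
  have h := Finset.sum_comm (s := (Finset.univ : Finset (ι × ι)))
    (t := (Finset.univ : Finset (κ × κ))) (f := fun x y => X x.1 x.2 y.1 y.2)
  simpa only [Fintype.sum_prod_type] using h

/-- The tensor `J^{⊗k} T`. -/
def tensorPull {k : ℕ} (J : Matrix (Fin d) (Fin d) ℝ) (T : (Fin k → Fin d) → ℝ)
    (i : Fin k → Fin d) : ℝ :=
  ∑ p : Fin k → Fin d, (∏ l, J (i l) (p l)) * T p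

/-- The quadratic form on `k`-tensors induced by the matrix `A`. -/
def tensorQuad {k : ℕ} (A : Matrix (Fin d) (Fin d) ℝ) (T : (Fin k → Fin d) → ℝ) : ℝ :=
  ∑ i : Fin k → Fin d, ∑ j : Fin k → Fin d, (∏ l, A (i l) (j l)) * T i * T j

theorem prod_sum_eq {k : ℕ} (X : Fin k → Fin d → ℝ) :
    ∏ l, ∑ a, X l a = ∑ i : Fin k → Fin d, ∏ l, X l (i l) := by
  rw [Finset.prod_univ_sum, Fintype.piFinset_univ]

/-- Multiplicativity of tensor powers: `(J^{⊗k})ᵀ A^{⊗k} J^{⊗k} = (Jᵀ A J)^{⊗k}`. -/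
theorem tensorQuad_pull {k : ℕ} (A J : Matrix (Fin d) (Fin d) ℝ) (T : (Fin k → Fin d) → ℝ) :
    tensorQuad A (tensorPull J T) = tensorQuad (J.transpose * A * J) T := by
  have h1 : ∀ p q : Fin k → Fin d, ∏ l, (J.transpose * A * J) (p l) (q l)
      = ∑ i : Fin k → Fin d, ∑ j : Fin k → Fin d,
        (∏ l, A (i l) (j l)) * (∏ l, J (i l) (p l)) * ∏ l, J (j l) (q l) := by
    intro p q
    have h2 : ∀ a b, (J.transpose * A * J) a b = ∑ u, ∑ v, A u v * J u a * J v b := by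
      intro a b
      simp only [Matrix.mul_apply, Matrix.transpose_apply, Finset.sum_mul]
      rw [Finset.sum_comm]
      exact Finset.sum_congr rfl fun _ _ => Finset.sum_congr rfl fun _ _ => by ring
    simp only [h2]
    rw [prod_sum_eq]
    refine Finset.sum_congr rfl fun i _ => ?_
    rw [prod_sum_eq]
    refine Finset.sum_congr rfl fun j _ => ?_
    simp only [Finset.prod_mul_distrib]
  simp only [tensorQuad, h1, tensorPull, Finset.sum_mul]
  rw [← sum_comm_pairs]
  refine Finset.sum_congr rfl fun i _ => Finset.sum_congr rfl fun j _ => ?_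
  simp only [Finset.mul_sum, Finset.sum_mul]
  rw [Finset.sum_comm]
  exact Finset.sum_congr rfl fun _ _ => Finset.sum_congr rfl fun _ _ => by ring

theorem prod_one_apply {k : ℕ} (i j : Fin k → Fin d) :
    ∏ l, (1 : Matrix (Fin d) (Fin d) ℝ) (i l) (j l) = if i = j then 1 else 0 := by
  simp only [Matrix.one_apply, Finset.prod_boole, Finset.mem_univ, true_implies, funext_iff]

theorem tensorQuad_one {k : ℕ} (T : (Fin k → Fin d) → ℝ) :
    tensorQuad 1 T = ∑ i, T i ^ 2 := by
  simp [tensorQuad, prod_one_apply, sq]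

theorem tensorPull_tensorPull {k : ℕ} (B C : Matrix (Fin d) (Fin d) ℝ)
    (T : (Fin k → Fin d) → ℝ) : tensorPull C (tensorPull B T) = tensorPull (C * B) T := by
  ext i
  simp only [tensorPull, Matrix.mul_apply, prod_sum_eq, Finset.mul_sum, Finset.sum_mul,
    Finset.prod_mul_distrib]
  rw [Finset.sum_comm]
  exact Finset.sum_congr rfl fun _ _ => Finset.sum_congr rfl fun _ _ => by ring

theorem tensorPull_one {k : ℕ} (T : (Fin k → Fin d) → ℝ) : tensorPull 1 T = T := by
  ext i
  simp [tensorPull, prod_one_apply]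

/-- A component of a tensor is bounded by its norm with respect to `G⁻¹`. -/
theorem abs_le_sqrt_tensorQuad {k : ℕ} {G : Matrix (Fin d) (Fin d) ℝ} (hG : G.PosDef)
    (T : (Fin k → Fin d) → ℝ) (i : Fin k → Fin d) :
    |T i| ≤ Real.sqrt (∏ l, G (i l) (i l)) * Real.sqrt (tensorQuad G⁻¹ T) := by
  -- With `G⁻¹ = Bᵀ B`, the matrix `C = G Bᵀ` is inverse to `B` and satisfies `C Cᵀ = G`. Hence `T =
  -- C^{⊗k}(B^{⊗k} T)`, where `B^{⊗k} T` has Euclidean norm equal to the `G⁻¹`-norm of `T`;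
  -- Cauchy–Schwarz on one row of `C^{⊗k}` gives the bound.
  obtain ⟨B, hB⟩ := exists_factor hG.inv.posSemidef
  rw [Matrix.conjTranspose_eq_transpose_of_trivial] at hB
  have hGu : IsUnit G.det := hG.det_pos.ne'.isUnit
  have hinv : G * B.transpose * B = 1 := by
    rw [Matrix.mul_assoc, ← hB, Matrix.mul_nonsing_inv _ hGu]
  have hinv' : B * (G * B.transpose) = 1 := mul_eq_one_comm.1 hinv
  have hCC : (G * B.transpose) * (G * B.transpose).transpose = G := by
    have hsymm : G.transpose = G := by
      simpa [Matrix.conjTranspose_eq_transpose_of_trivial] using hG.isHermitian.eq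
    rw [Matrix.transpose_mul, Matrix.transpose_transpose, hsymm, ← Matrix.mul_assoc, hinv,
      Matrix.one_mul]
  have hQ : tensorQuad G⁻¹ T = ∑ m, tensorPull B T m ^ 2 := by
    rw [← tensorQuad_one, tensorQuad_pull, Matrix.mul_one, ← hB]
  have hT : T i = ∑ m : Fin k → Fin d, (∏ l, (G * B.transpose) (i l) (m l)) * tensorPull B T m := by
    conv_lhs => rw [← tensorPull_one T, ← hinv, ← tensorPull_tensorPull]
    rfl
  have hP : ∑ m : Fin k → Fin d, (∏ l, (G * B.transpose) (i l) (m l)) ^ 2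
      = ∏ l, G (i l) (i l) := by
    simp only [← Finset.prod_pow]
    rw [← prod_sum_eq fun l a => (G * B.transpose) (i l) a ^ 2]
    refine Finset.prod_congr rfl fun l _ => ?_
    conv_rhs => rw [← hCC]
    rw [Matrix.mul_apply]
    simp only [Matrix.transpose_apply, sq]
  rw [← Real.sqrt_mul (Finset.prod_nonneg fun l _ => (hG.diag_pos (i := i l)).le), hQ, ← hP, hT]
  exact Real.abs_le_sqrt (Finset.sum_mul_sq_le_sq_mul_sq _ _ _)

end TensorNorm

/-! ### Chart independence of `|∇ᵏ f|`. -/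

section CovNorm

variable {d : ℕ} {M : Type*} [TopologicalSpace M] [ChartedSpace (Euc d) M]
  [IsManifold 𝓘(ℝ, Euc d) ∞ M] {e e' : OpenPartialHomeomorph M (Euc d)}

theorem covDeriv_congr {s : Set (Euc d)} (hs : IsOpen s)
    {Γ : Fin d → Fin d → Fin d → Euc d → ℝ} {F G : Euc d → ℝ} (h : ∀ y ∈ s, F y = G y) (k : ℕ) :
    ∀ (i : Fin k → Fin d), ∀ y ∈ s, covDeriv Γ F k i y = covDeriv Γ G k i y := by
  induction k with
  | zero => intro i y hy; exact h y hy
  | succ k ih =>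
    intro i y hy
    simp only [covDeriv, ih _ y hy]
    rw [partialDeriv_congr_of_isOpen hs (ih (Fin.tail i)) hy]

theorem contDiffOn_chart (he : e ∈ smoothCharts d M) {k : ℕ} {f : M → ℝ}
    (hf : ContMDiff 𝓘(ℝ, Euc d) 𝓘(ℝ) (k : ℕ∞ω) f) :
    ContDiffOn ℝ (k : ℕ∞ω) (fun z => f (e.symm z)) e.target :=
  contMDiffOn_iff_contDiffOn.1 (hf.comp_contMDiffOn
    ((contMDiffOn_symm_of_mem_maximalAtlas he).of_le (natCast_le_infty k)))

theorem covCoord_transition (g : RiemMetric d M) (he : e ∈ smoothCharts d M)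
    (he' : e' ∈ smoothCharts d M) {k : ℕ} {f : M → ℝ}
    (hf : ContMDiff 𝓘(ℝ, Euc d) 𝓘(ℝ) (k : ℕ∞ω) f) {y : Euc d}
    (hy : y ∈ (e.symm ≫ₕ e').source) :
    (fun i => covCoord g e f k i y)
      = tensorPull (jacobian e e' y) fun p => covCoord g e' f k p (e' (e.symm y)) := by
  ext i
  have hs := (e.symm ≫ₕ e').open_source
  simp only [covCoord_eq_covDeriv]
  rw [covDeriv_congr hs (G := fun z => f (e'.symm (e' (e.symm z)))) (fun z hz => ?_) k i y hy]
  · exact covDeriv_comp hs e'.open_target (transition_contDiffOn he he')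
      (fun z hz => e'.map_source hz.2) (fun a i j => christoffel_contDiffOn g he' a i j)
      (fun y hy i j c => christoffel_transition g he he' hy i j c)
      k (contDiffOn_chart he' hf) i y hy
  · rw [show e'.symm (e' (e.symm z)) = e.symm z from e'.left_inv hz.2]

theorem gram_inv_transition (g : RiemMetric d M) (he : e ∈ smoothCharts d M)
    (he' : e' ∈ smoothCharts d M) {y : Euc d} (hy : y ∈ (e.symm ≫ₕ e').source) :
    (jacobian e e' y).transpose * (gram g e y)⁻¹ * jacobian e e' y
      = (gram g e' (e' (e.symm y)))⁻¹ := by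
  have hJ : IsUnit (jacobian e e' y).det := (jacobian_det_ne_zero g he he' hy).isUnit
  have hJt : IsUnit (jacobian e e' y).transpose.det := by rwa [Matrix.det_transpose]
  rw [gram_transition_matrix g he he' hy, Matrix.mul_inv_rev, Matrix.mul_inv_rev]
  rw [← Matrix.mul_assoc, Matrix.mul_nonsing_inv _ hJt, Matrix.one_mul, Matrix.mul_assoc,
    Matrix.nonsing_inv_mul _ hJ, Matrix.mul_one]

/-- The components transform by `J^{⊗k}` and the inverse Gram matrices by `Jᵀ G⁻¹ J = G'⁻¹`, so the
Jacobians cancel in the quadratic form. -/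
theorem covNormIn_eq (g : RiemMetric d M) (he : e ∈ smoothCharts d M)
    (he' : e' ∈ smoothCharts d M) {k : ℕ} {f : M → ℝ}
    (hf : ContMDiff 𝓘(ℝ, Euc d) 𝓘(ℝ) (k : ℕ∞ω) f) {x : M} (hx : x ∈ e.source)
    (hx' : x ∈ e'.source) : covNormIn g e k f x = covNormIn g e' k f x := by
  have hy : e x ∈ (e.symm ≫ₕ e').source := ⟨e.map_source hx, by simpa [hx] using hx'⟩
  have h : tensorQuad (gram g e (e x))⁻¹ (fun i => covCoord g e f k i (e x))
      = tensorQuad (gram g e' (e' x))⁻¹ (fun i => covCoord g e' f k i (e' x)) := by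
    rw [covCoord_transition g he he' hf hy, tensorQuad_pull, gram_inv_transition g he he' hy,
      show e.symm (e x) = x from e.left_inv hx]
  exact congrArg Real.sqrt h

theorem covNorm_eq (g : RiemMetric d M) (he : e ∈ smoothCharts d M) {k : ℕ} {f : M → ℝ}
    (hf : ContMDiff 𝓘(ℝ, Euc d) 𝓘(ℝ) (k : ℕ∞ω) f) {x : M} (hx : x ∈ e.source) :
    covNorm g k f x = ENNReal.ofReal (covNormIn g e k f x) := by
  refine le_antisymm (iSup₂_le fun e' he' => iSup_le fun hx' => ?_)
    (le_iSup₂_of_le e he (le_iSup_of_le hx le_rfl))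
  rw [covNormIn_eq g he' he hf hx' hx]

end CovNorm

/-! ### Pointwise bound for `|∇ᵏ(Hf)|` when `H` is simple. -/

section PointwiseBound

variable {d : ℕ} {M : Type*} [TopologicalSpace M] [ChartedSpace (Euc d) M]
  [IsManifold 𝓘(ℝ, Euc d) ∞ M] {e : OpenPartialHomeomorph M (Euc d)}

theorem sqrt_tensorQuad_le {k : ℕ} (A : Matrix (Fin d) (Fin d) ℝ) (T : (Fin k → Fin d) → ℝ)
    {τ : ℝ} (hτ : 0 ≤ τ) (hT : ∀ i, |T i| ≤ τ) :
    Real.sqrt (tensorQuad A T)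
      ≤ Real.sqrt (∑ i : Fin k → Fin d, ∑ j : Fin k → Fin d, |∏ l, A (i l) (j l)|) * τ := by
  rw [← Real.sqrt_sq hτ, ← Real.sqrt_mul (Finset.sum_nonneg fun i _ =>
    Finset.sum_nonneg fun j _ => abs_nonneg _)]
  refine Real.sqrt_le_sqrt ?_
  simp only [tensorQuad, Finset.sum_mul]
  refine Finset.sum_le_sum fun i _ => Finset.sum_le_sum fun j _ => ?_
  refine (le_abs_self _).trans ?_
  rw [abs_mul, abs_mul, mul_assoc, sq]
  exact mul_le_mul_of_nonneg_left (mul_le_mul (hT i) (hT j) (abs_nonneg _) hτ) (abs_nonneg _)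

/-- No regularity of `f` away from `x` is assumed, so `covNorm_eq` is not available; the vanishing
is checked in each chart of the supremum. -/
theorem covNorm_eq_zero_of_eventually (g : RiemMetric d M) (k : ℕ) {f : M → ℝ} {x : M}
    (hf : f =ᶠ[𝓝 x] 0) : covNorm g k f x = 0 := by
  refine le_antisymm (iSup₂_le fun e he => iSup_le fun hx => ?_) bot_le
  obtain ⟨W, hW, hWo, hxW⟩ := eventually_nhds_iff.1 hf
  have hs : IsOpen (e.target ∩ e.symm ⁻¹' W) := e.isOpen_inter_preimage_symm hWo
  have hy : e x ∈ e.target ∩ e.symm ⁻¹' W := ⟨e.map_source hx, by simpa [hx] using hxW⟩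
  have hzero : ∀ (k : ℕ) (i : Fin k → Fin d) (y : Euc d),
      covDeriv (christoffel g e) (fun _ => 0) k i y = 0 := by
    intro k
    induction k with
    | zero => intro i y; rfl
    | succ k ih => intro i y; simp [covDeriv, ih, partialDeriv]
  have h : ∀ i : Fin k → Fin d, covCoord g e f k i (e x) = 0 := fun i => by
    rw [covCoord_eq_covDeriv, covDeriv_congr hs (G := fun _ => 0) (fun z hz => hW _ hz.2) k i _ hy,
      hzero]
  simp [covNormIn, h]

namespace SimpleH

variable (S : SimpleH d M)

/-- The chart `e ∘ Φ⁻¹`. -/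
def pushChart (e : OpenPartialHomeomorph M (Euc d)) : OpenPartialHomeomorph M (Euc d) :=
  S.Φ.toOpenPartialHomeomorph.symm ≫ₕ e

theorem pushChart_apply {z : M} (hz : z ∈ S.V) : S.pushChart e (S.Φ z) = e z :=
  congrArg e (S.Φ.toOpenPartialHomeomorph.left_inv hz)

theorem apply_mem_pushChart_source {z : M} (hz : z ∈ S.V) (hze : z ∈ e.source) :
    S.Φ z ∈ (S.pushChart e).source := by
  refine ⟨S.Φ.toOpenPartialHomeomorph.map_source hz, ?_⟩
  change S.Φ.toOpenPartialHomeomorph.symm (S.Φ.toOpenPartialHomeomorph z) ∈ e.source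
  rwa [S.Φ.toOpenPartialHomeomorph.left_inv hz]

/-- Smoothness of `Φ⁻¹` and of `Φ` gives the two directions. Read in `e` and `pushChart e`, the map
`Φ` is the identity, so no chain rule for `Φ` is needed later. -/
theorem pushChart_mem (he : e ∈ smoothCharts d M) : S.pushChart e ∈ smoothCharts d M := by
  refine OpenPartialHomeomorph.mem_maximalAtlas_of_contMDiffOn _ ?_ ?_
  · exact (contMDiffOn_of_mem_maximalAtlas he).comp
      (S.Φ.contMDiffOn_invFun.mono fun z hz => hz.1) fun z hz => hz.2
  · exact S.Φ.contMDiffOn_toFun.comp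
      ((contMDiffOn_symm_of_mem_maximalAtlas he).mono fun z hz => hz.1) fun z hz => hz.2

/-- The open sets `V` and the complement of `tsupport φ` cover `M`; on the second one the function
vanishes. -/
theorem contMDiff_act {n : ℕ∞ω} (hn : n ≤ (∞ : ℕ∞ω)) {f : M → ℝ}
    (hf : ContMDiff 𝓘(ℝ, Euc d) 𝓘(ℝ) n f) : ContMDiff 𝓘(ℝ, Euc d) 𝓘(ℝ) n (S.act f) := by
  intro x
  by_cases hx : x ∈ S.V
  · have hV : S.V ∈ 𝓝 x := S.Φ.open_source.mem_nhds hx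
    have h : ContMDiffAt 𝓘(ℝ, Euc d) 𝓘(ℝ) n (fun z => S.φ z * f (S.Φ z)) x :=
      (S.contMDiff_φ.of_le hn).contMDiffAt.mul (hf.contMDiffAt.comp x
        ((S.Φ.contMDiffOn_toFun.of_le hn).contMDiffAt hV))
    refine h.congr_of_eventuallyEq ?_
    filter_upwards [hV] with z hz
    simp [act, hz]
  · have hx' : x ∈ (tsupport S.φ)ᶜ := fun h => hx (S.tsupport_subset h)
    refine (contMDiffAt_const (c := (0 : ℝ))).congr_of_eventuallyEq ?_
    filter_upwards [(isClosed_tsupport S.φ).isOpen_compl.mem_nhds hx'] with z hz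
    exact S.act_eq_zero f hz

theorem covNorm_act_eq_zero (g : RiemMetric d M) (k : ℕ) (f : M → ℝ) {x : M}
    (hx : x ∉ tsupport S.φ) : covNorm g k (S.act f) x = 0 := by
  refine covNorm_eq_zero_of_eventually g k ?_
  filter_upwards [(isClosed_tsupport S.φ).isOpen_compl.mem_nhds hx] with z hz
  exact S.act_eq_zero f hz

theorem exists_covNorm_act_le_nhds (g : RiemMetric d M) (k : ℕ) {x : M} (hx : x ∈ S.V) :
    ∃ W ∈ 𝓝 x, ∃ C : NNReal, ∀ f : M → ℝ, ContMDiff 𝓘(ℝ, Euc d) 𝓘(ℝ) (k : ℕ∞ω) f → ∀ z ∈ W,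
      covNorm g k (S.act f) z ≤ C * ∑ j ∈ Finset.range (k + 1), covNorm g j f (S.Φ z) := by
  set e := chartAt (Euc d) x with he_def
  have he : e ∈ smoothCharts d M := IsManifold.chart_mem_maximalAtlas x
  set e' := S.pushChart e with he'_def
  have he' : e' ∈ smoothCharts d M := S.pushChart_mem he
  have hxe : x ∈ e.source := mem_chart_source _ x
  have hs : IsOpen e'.target := e'.open_target
  have hsub : e'.target ⊆ e.target := fun y hy => hy.1
  have hy₀ : e x ∈ e'.target := ⟨e.map_source hxe, by
    change e.symm (e x) ∈ S.V
    rwa [e.left_inv hxe]⟩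
  have hφ : ContDiffOn ℝ ∞ (fun y => S.φ (e.symm y)) e'.target :=
    (contMDiffOn_iff_contDiffOn.1 (S.contMDiff_φ.comp_contMDiffOn
      (contMDiffOn_symm_of_mem_maximalAtlas he))).mono hsub
  -- The base connection is that of `e'`, in which `f` is measured; the differentiated product `φF`
  -- uses that of `e`.
  have hcomb := fun i : Fin k → Fin d => (LowerComb.covDeriv_mul hs
    (fun a i j => christoffel_contDiffOn g he' a i j)
    (fun a i j => (christoffel_contDiffOn g he a i j).mono hsub) hφ k i).eventually_le hs hy₀
  choose c hc0 hc using hcomb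
  -- `D` bounds components by norms in `e'`, and `E` bounds a norm in `e` by its components. Both
  -- are continuous, so near `x` they exceed their value at `e x` by less than one.
  let D : Euc d → ℝ := fun y => ∑ j ∈ Finset.range (k + 1), ∑ m : Fin j → Fin d,
    Real.sqrt (∏ l, gram g e' y (m l) (m l))
  let E : Euc d → ℝ := fun y => Real.sqrt (∑ i : Fin k → Fin d, ∑ j : Fin k → Fin d,
    |∏ l, (gram g e y)⁻¹ (i l) (j l)|)
  have hD : ContinuousAt D (e x) := by
    refine (continuousOn_finsetSum _ fun j _ => continuousOn_finsetSum _ fun m _ =>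
      Real.continuous_sqrt.comp_continuousOn (continuousOn_finsetProd _ fun l _ =>
        (gram_contDiffOn g he' _ _).continuousOn)).continuousAt (hs.mem_nhds hy₀)
  have hE : ContinuousAt E (e x) := by
    refine (Real.continuous_sqrt.comp_continuousOn (continuousOn_finsetSum _ fun i _ =>
      continuousOn_finsetSum _ fun j _ => (continuousOn_finsetProd _ fun l _ =>
        (gram_inv_contDiffOn g he _ _).continuousOn).abs)).continuousAt
          (e.open_target.mem_nhds (hsub hy₀))
  have hD0 : ∀ y, 0 ≤ D y := fun y => Finset.sum_nonneg fun j _ => Finset.sum_nonneg fun m _ =>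
    Real.sqrt_nonneg _
  have hE0 : ∀ y, 0 ≤ E y := fun y => Real.sqrt_nonneg _
  have hev : ∀ᶠ z in 𝓝 x, z ∈ S.V ∧ z ∈ e.source ∧ D (e z) < D (e x) + 1 ∧ E (e z) < E (e x) + 1 ∧
      ∀ i, ∀ F, ContDiffOn ℝ (k : ℕ∞ω) F e'.target →
      |covDeriv (christoffel g e) (fun y => S.φ (e.symm y) * F y) k i (e z)| ≤ c i *
        ∑ j ∈ Finset.range (k + 1), ∑ m : Fin j → Fin d,
          |covDeriv (christoffel g e') F j m (e z)| := by
    have hex : ContinuousAt e x := e.continuousAt hxe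
    filter_upwards [S.Φ.open_source.mem_nhds hx, e.open_source.mem_nhds hxe,
      hex.eventually (hD.eventually_lt_const (lt_add_one _)),
      hex.eventually (hE.eventually_lt_const (lt_add_one _)),
      hex.eventually (Filter.eventually_all.2 hc)] with z h1 h2 h3 h4 h5
    exact ⟨h1, h2, h3, h4, h5⟩
  refine ⟨_, hev, Real.toNNReal ((E (e x) + 1) * ((∑ i, c i) * (D (e x) + 1))), ?_⟩
  rintro f hf z ⟨hzV, hze, hDz, hEz, hcz⟩
  have hact := S.contMDiff_act (natCast_le_infty k) hf
  have hF : ContDiffOn ℝ (k : ℕ∞ω) (fun y => f (e'.symm y)) e'.target := contDiffOn_chart he' hf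
  have hzy : e z ∈ e'.target := ⟨e.map_source hze, by
    change e.symm (e z) ∈ S.V
    rwa [e.left_inv hze]⟩
  have hez : e' (S.Φ z) = e z := S.pushChart_apply hzV
  have hΦz : S.Φ z ∈ e'.source := S.apply_mem_pushChart_source hzV hze
  let N : ℕ → ℝ := fun j => covNormIn g e' j f (S.Φ z)
  have hN0 : ∀ j, 0 ≤ N j := fun j => Real.sqrt_nonneg _
  have hsum : ∑ j ∈ Finset.range (k + 1), ∑ m : Fin j → Fin d,
      |covDeriv (christoffel g e') (fun y => f (e'.symm y)) j m (e z)|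
      ≤ (D (e x) + 1) * ∑ j ∈ Finset.range (k + 1), N j := by
    refine le_trans ?_ (mul_le_mul_of_nonneg_right hDz.le (Finset.sum_nonneg fun j _ => hN0 j))
    rw [Finset.sum_mul]
    refine Finset.sum_le_sum fun j hj => ?_
    rw [Finset.sum_mul]
    refine Finset.sum_le_sum fun m _ => ?_
    have h1 := abs_le_sqrt_tensorQuad (gram_posDef g he' hzy)
      (fun m => covCoord g e' f j m (e z)) m
    rw [covCoord_eq_covDeriv] at h1
    refine h1.trans (mul_le_mul_of_nonneg_left ?_ (Real.sqrt_nonneg _))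
    refine le_trans (le_of_eq ?_) (Finset.single_le_sum (fun j _ => hN0 j) hj)
    simp only [N, covNormIn, hez, tensorQuad]
  have hcomp : ∀ i : Fin k → Fin d, |covCoord g e (S.act f) k i (e z)|
      ≤ (∑ i, c i) * ((D (e x) + 1) * ∑ j ∈ Finset.range (k + 1), N j) := by
    intro i
    -- On `e'.target` one has `e'.symm = Φ ∘ e.symm`, so the action reads `φ(e.symm y) * f(e'.symm
    -- y)`.
    rw [covCoord_eq_covDeriv, covDeriv_congr hs
      (G := fun y => S.φ (e.symm y) * f (e'.symm y)) (fun y hy => ?_) k i _ hzy]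
    · exact (hcz i _ hF).trans (mul_le_mul (Finset.single_le_sum (fun i _ => hc0 i)
        (Finset.mem_univ i)) hsum (Finset.sum_nonneg fun j _ => Finset.sum_nonneg fun m _ =>
          abs_nonneg _) (Finset.sum_nonneg fun i _ => hc0 i))
    · have hyV : e.symm y ∈ S.V := hy.2
      simp only [act, hyV, if_true]
      rfl
  have hNs : 0 ≤ ∑ j ∈ Finset.range (k + 1), N j := Finset.sum_nonneg fun j _ => hN0 j
  have hcs : 0 ≤ ∑ i, c i := Finset.sum_nonneg fun i _ => hc0 i
  have hD1 : 0 ≤ D (e x) + 1 := add_nonneg (hD0 _) zero_le_one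
  have hE1 : 0 ≤ E (e x) + 1 := add_nonneg (hE0 _) zero_le_one
  have hmain : covNormIn g e k (S.act f) z
      ≤ (E (e x) + 1) * ((∑ i, c i) * (D (e x) + 1)) * ∑ j ∈ Finset.range (k + 1), N j := by
    have h1 := sqrt_tensorQuad_le (gram g e (e z))⁻¹ _
      (mul_nonneg hcs (mul_nonneg hD1 hNs)) hcomp
    refine h1.trans ((mul_le_mul_of_nonneg_right hEz.le
      (mul_nonneg hcs (mul_nonneg hD1 hNs))).trans (le_of_eq ?_))
    ring
  -- Chart independence is needed only on this side; on the right a single chart already bounds the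
  -- supremum from below.
  rw [covNorm_eq g he hact hze]
  refine (ENNReal.ofReal_le_ofReal hmain).trans ?_
  rw [ENNReal.ofReal_mul (mul_nonneg hE1 (mul_nonneg hcs hD1)),
    ENNReal.ofReal_sum_of_nonneg fun j _ => hN0 j]
  refine mul_le_mul_right ?_ _
  exact Finset.sum_le_sum fun j _ => le_iSup₂_of_le e' he' (le_iSup_of_le hΦz le_rfl)

theorem exists_covNorm_act_le (g : RiemMetric d M) (k : ℕ) :
    ∃ C : NNReal, ∀ f : M → ℝ, ContMDiff 𝓘(ℝ, Euc d) 𝓘(ℝ) (k : ℕ∞ω) f → ∀ z ∈ tsupport S.φ,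
      covNorm g k (S.act f) z ≤ C * ∑ j ∈ Finset.range (k + 1), covNorm g j f (S.Φ z) := by
  refine IsCompact.induction_on (p := fun s => ∃ C : NNReal, ∀ f : M → ℝ,
    ContMDiff 𝓘(ℝ, Euc d) 𝓘(ℝ) (k : ℕ∞ω) f → ∀ z ∈ s,
      covNorm g k (S.act f) z ≤ C * ∑ j ∈ Finset.range (k + 1), covNorm g j f (S.Φ z))
    S.hasCompactSupport_φ ⟨0, by simp⟩ ?_ ?_ ?_
  · rintro s t hst ⟨C, hC⟩
    exact ⟨C, fun f hf z hz => hC f hf z (hst hz)⟩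
  · rintro s t ⟨C, hC⟩ ⟨C', hC'⟩
    refine ⟨max C C', fun f hf z hz => ?_⟩
    rcases hz with hz | hz
    · exact (hC f hf z hz).trans (mul_le_mul_left (by exact_mod_cast le_max_left _ _) _)
    · exact (hC' f hf z hz).trans (mul_le_mul_left (by exact_mod_cast le_max_right _ _) _)
  · intro x hx
    obtain ⟨W, hW, C, hC⟩ := S.exists_covNorm_act_le_nhds g k (S.tsupport_subset hx)
    exact ⟨W, mem_nhdsWithin_of_mem_nhds hW, C, hC⟩

end SimpleH

end PointwiseBound

/-! ### Change of variables for the Riemannian measure. -/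

section RiemannianMeasure

theorem measurableSet_inter_preimage_of_continuousOn {X Y : Type*} [TopologicalSpace X]
    [MeasurableSpace X] [BorelSpace X] [TopologicalSpace Y] [MeasurableSpace Y] [BorelSpace Y]
    {f : X → Y} {s : Set X} (hs : MeasurableSet s) (hf : ContinuousOn f s) {A : Set Y}
    (hA : MeasurableSet A) : MeasurableSet (s ∩ f ⁻¹' A) := by
  have h := hs.subtype_image ((continuousOn_iff_continuous_domRestrict.1 hf).measurable hA)
  convert h using 1
  ext x
  simp only [Set.mem_inter_iff, Set.mem_preimage, Set.mem_image, Subtype.exists, Set.domRestrict_apply,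
    exists_and_right, exists_eq_right]
  exact ⟨fun h => ⟨h.1, h.2⟩, fun ⟨h1, h2⟩ => ⟨h1, h2⟩⟩

variable {d : ℕ} {M : Type*} [TopologicalSpace M] [ChartedSpace (Euc d) M]
  [IsManifold 𝓘(ℝ, Euc d) ∞ M] {e e' : OpenPartialHomeomorph M (Euc d)}

/-- `jacobian` is the transpose of the matrix of the derivative, which the determinant does not see.
-/
theorem det_fderiv_transition (he : e ∈ smoothCharts d M) (he' : e' ∈ smoothCharts d M)
    {y : Euc d} (hy : y ∈ (e.symm ≫ₕ e').source) :
    (fderiv ℝ (fun z => e' (e.symm z)) y).det = (jacobian e e' y).det := by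
  have hψ : DifferentiableAt ℝ (fun y => e' (e.symm y)) y :=
    ((transition_contDiffOn he he').contDiffAt
      ((e.symm ≫ₕ e').open_source.mem_nhds hy)).differentiableAt (by simp)
  rw [ContinuousLinearMap.det, ← LinearMap.det_toMatrix (EuclideanSpace.basisFun (Fin d) ℝ).toBasis,
    ← Matrix.det_transpose]
  congr 1
  ext i p
  have h6 := (EuclideanSpace.proj p : Euc d →L[ℝ] ℝ).hasFDerivAt.comp y hψ.hasFDerivAt
  have h7 : jacobian e e' y i p = fderiv ℝ (fun y => e' (e.symm y)) y (basisVec i) p := by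
    change fderiv ℝ ((EuclideanSpace.proj p : Euc d →L[ℝ] ℝ) ∘ fun y => e' (e.symm y)) y
      (basisVec i) = _
    rw [h6.fderiv]
    rfl
  rw [h7, Matrix.transpose_apply, LinearMap.toMatrix_apply]
  simp

theorem sqrt_det_gram_transition (g : RiemMetric d M) (he : e ∈ smoothCharts d M)
    (he' : e' ∈ smoothCharts d M) {y : Euc d} (hy : y ∈ (e.symm ≫ₕ e').source) :
    Real.sqrt (gram g e y).det
      = |(jacobian e e' y).det| * Real.sqrt (gram g e' (e' (e.symm y))).det := by
  rw [gram_transition_matrix g he he' hy, Matrix.det_mul, Matrix.det_mul, Matrix.det_transpose,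
    ← Real.sqrt_sq_eq_abs, ← Real.sqrt_mul (sq_nonneg _)]
  congr 1
  ring

variable [MeasurableSpace M] [BorelSpace M]

/-- The transition map carries the overlap part of `A` in `e` onto its part in `e'`, and `|det J|
√det G' = √det G` turns one density into the other. The inequality comes from then enlarging the
domain to all of `A` in `e`. -/
theorem chartMeasure_inter_le (g : RiemMetric d M) (he : e ∈ smoothCharts d M)
    (he' : e' ∈ smoothCharts d M) {A : Set M} (hA : MeasurableSet A) :
    chartMeasure g e' (A ∩ e.source) ≤ chartMeasure g e A := by
  set s := (e.symm ≫ₕ e').source with hs_def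
  have hs : IsOpen s := (e.symm ≫ₕ e').open_source
  have hT : MeasurableSet (s ∩ e.symm ⁻¹' A) :=
    measurableSet_inter_preimage_of_continuousOn hs.measurableSet
      (e.continuousOn_symm.mono fun y hy => hy.1) hA
  have himage : (fun z => e' (e.symm z)) '' (s ∩ e.symm ⁻¹' A)
      = e'.symm ⁻¹' (A ∩ e.source) ∩ e'.target := by
    ext w
    constructor
    · rintro ⟨y, ⟨hy, hyA⟩, rfl⟩
      refine ⟨?_, e'.map_source hy.2⟩
      rw [Set.mem_preimage, show e'.symm (e' (e.symm y)) = e.symm y from e'.left_inv hy.2]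
      exact ⟨hyA, e.map_target hy.1⟩
    · rintro ⟨⟨hwA, hwe⟩, hw⟩
      have h1 : e.symm (e (e'.symm w)) = e'.symm w := e.left_inv hwe
      refine ⟨e (e'.symm w), ⟨⟨e.map_source hwe, ?_⟩, ?_⟩, ?_⟩
      · rw [Set.mem_preimage]
        change e.symm (e (e'.symm w)) ∈ e'.source
        rw [h1]
        exact e'.map_target hw
      · rwa [Set.mem_preimage, h1]
      · simp only [h1]
        exact e'.right_inv hw
  rw [chartMeasure_apply g (hA.inter e.open_source.measurableSet), chartMeasure_apply g hA,
    ← himage, lintegral_image_eq_lintegral_abs_det_fderiv_mul volume hT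
      (f' := fun y => fderiv ℝ (fun z => e' (e.symm z)) y)]
  · refine le_trans (le_of_eq (setLIntegral_congr_fun hT fun y hy => ?_))
      (lintegral_mono_set fun y hy => ⟨hy.2, hy.1.1⟩)
    rw [det_fderiv_transition he he' hy.1, ← ENNReal.ofReal_mul (abs_nonneg _),
      ← sqrt_det_gram_transition g he he' hy.1]
  · intro y hy
    exact (((transition_contDiffOn he he').contDiffAt (hs.mem_nhds hy.1)).differentiableAt
      (by simp)).hasFDerivAt.hasFDerivWithinAt
  · exact (e.symm ≫ₕ e').injOn.mono fun y hy => hy.1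

/-- A supremum of measures is not computed set by set, so an explicit majorant of all chart measures
is used: `chartMeasure g e` plus the restriction of `riemMeasure g` to the complement of `e.source`.
On `e.source` the second term vanishes. -/
theorem riemMeasure_restrict_le (g : RiemMetric d M) (he : e ∈ smoothCharts d M) :
    (riemMeasure g).restrict e.source ≤ chartMeasure g e := by
  have hes : MeasurableSet e.source := e.open_source.measurableSet
  have h : riemMeasure g ≤ chartMeasure g e + (riemMeasure g).restrict e.sourceᶜ := by
    refine iSup₂_le fun e' he' => Measure.le_iff.2 fun A hA => ?_
    rw [Measure.add_apply, Measure.restrict_apply hA, ← measure_inter_add_sdiff A hes]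
    refine add_le_add (chartMeasure_inter_le g he he' hA) ?_
    exact (le_iSup₂ (f := fun e (_ : e ∈ smoothCharts d M) => chartMeasure g e) e' he') _
  refine Measure.le_iff.2 fun A hA => ?_
  rw [Measure.restrict_apply hA]
  refine (h _).trans ?_
  rw [Measure.add_apply, Measure.restrict_apply (hA.inter hes),
    show A ∩ e.source ∩ e.sourceᶜ = ∅ by ext; simp, measure_empty, add_zero]
  exact measure_mono Set.inter_subset_left

namespace SimpleH

variable (S : SimpleH d M)

/-- In `e` and `pushChart e` the points `z` and `Φ z` have the same coordinates, so only the two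
densities need comparing. -/
theorem exists_map_restrict_le_nhds (g : RiemMetric d M) {x : M} (hx : x ∈ S.V) :
    ∃ W : Set M, IsOpen W ∧ x ∈ W ∧ W ⊆ S.V ∧ ∃ C : NNReal,
      ((riemMeasure g).restrict W).map S.Φ ≤ C • riemMeasure g := by
  set e := chartAt (Euc d) x with he_def
  have he : e ∈ smoothCharts d M := IsManifold.chart_mem_maximalAtlas x
  set e' := S.pushChart e with he'_def
  have he' : e' ∈ smoothCharts d M := S.pushChart_mem he
  have hxe : x ∈ e.source := mem_chart_source _ x
  have hy₀ : e x ∈ e'.target := ⟨e.map_source hxe, by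
    change e.symm (e x) ∈ S.V
    rwa [e.left_inv hxe]⟩
  have hcont : ∀ {e : OpenPartialHomeomorph M (Euc d)}, e ∈ smoothCharts d M →
      ∀ {y}, y ∈ e.target → ContinuousAt (fun y => Real.sqrt (gram g e y).det) y :=
    fun {e} he {y} hy => (Real.continuous_sqrt.comp_continuousOn (contDiffOn_det fun i j =>
      gram_contDiffOn g he i j).continuousOn).continuousAt (e.open_target.mem_nhds hy)
  set a := Real.sqrt (gram g e (e x)).det with ha
  set b := Real.sqrt (gram g e' (e x)).det with hb
  have ha0 : 0 ≤ a := Real.sqrt_nonneg _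
  have hb0 : 0 < b := Real.sqrt_pos.2 (gram_posDef g he' hy₀).det_pos
  have hex : ContinuousAt e x := e.continuousAt hxe
  have hev : ∀ᶠ z in 𝓝 x, z ∈ S.V ∧ z ∈ e.source ∧ Real.sqrt (gram g e (e z)).det < a + 1 ∧
      b / 2 < Real.sqrt (gram g e' (e z)).det := by
    filter_upwards [S.Φ.open_source.mem_nhds hx, e.open_source.mem_nhds hxe,
      hex.eventually ((hcont he (e.map_source hxe)).eventually_lt_const (lt_add_one _)),
      hex.eventually ((hcont he' hy₀).eventually_const_lt (half_lt_self hb0))] with z h1 h2 h3 h4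
    exact ⟨h1, h2, h3, h4⟩
  obtain ⟨W, hW, hWo, hxW⟩ := eventually_nhds_iff.1 hev
  have hWV : W ⊆ S.V := fun z hz => (hW z hz).1
  have hΦ : ContinuousOn S.Φ W := S.Φ.contMDiffOn_toFun.continuousOn.mono hWV
  -- On `W` the density in `e` is below `a + 1` and the one in `e'` is above `b / 2`, so their ratio
  -- is at most this constant.
  refine ⟨W, hWo, hxW, hWV, Real.toNNReal ((a + 1) / (b / 2)), Measure.le_iff.2 fun A hA => ?_⟩
  have hB : MeasurableSet (W ∩ S.Φ ⁻¹' A) :=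
    measurableSet_inter_preimage_of_continuousOn hWo.measurableSet hΦ hA
  rw [Measure.map_apply_of_aemeasurable (hΦ.aemeasurable hWo.measurableSet) hA,
    Measure.restrict_apply' hWo.measurableSet, Set.inter_comm]
  have h1 : riemMeasure g (W ∩ S.Φ ⁻¹' A) ≤ chartMeasure g e (W ∩ S.Φ ⁻¹' A) := by
    refine le_trans (le_of_eq ?_) (riemMeasure_restrict_le g he _)
    rw [Measure.restrict_apply hB, Set.inter_eq_left.2 fun z hz => (hW z hz.1).2.1]
  refine h1.trans ?_
  have h2 : chartMeasure g e' A ≤ riemMeasure g A :=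
    (le_iSup₂ (f := fun e (_ : e ∈ smoothCharts d M) => chartMeasure g e) e' he') _
  refine le_trans ?_ (mul_le_mul_right h2 _)
  rw [chartMeasure_apply g hA, chartMeasure_apply g hB,
    ← lintegral_const_mul' _ _ ENNReal.coe_ne_top]
  have hT : MeasurableSet (e.symm ⁻¹' (W ∩ S.Φ ⁻¹' A) ∩ e.target) := by
    rw [Set.inter_comm]
    exact measurableSet_inter_preimage_of_continuousOn e.open_target.measurableSet
      e.continuousOn_symm hB
  refine le_trans (setLIntegral_mono' hT fun y hy => ?_)
    (lintegral_mono_set (fun y hy => ?_ : _ ⊆ e'.symm ⁻¹' A ∩ e'.target))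
  · have h3 := hW _ hy.1.1
    rw [show e (e.symm y) = y from e.right_inv hy.2] at h3
    rw [← ENNReal.ofReal, ← ENNReal.ofReal_mul (by positivity)]
    refine ENNReal.ofReal_le_ofReal ?_
    refine h3.2.2.1.le.trans ?_
    calc a + 1 = (a + 1) / (b / 2) * (b / 2) := by field_simp
      _ ≤ _ := mul_le_mul_of_nonneg_left h3.2.2.2.le (by positivity)
  · exact ⟨hy.1.2, hy.2, hWV hy.1.1⟩

theorem exists_lintegral_comp_le (g : RiemMetric d M) :
    ∃ C : NNReal, ∀ u : M → ℝ≥0∞, Measurable u →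
      ∫⁻ z in tsupport S.φ, u (S.Φ z) ∂(riemMeasure g) ≤ C * ∫⁻ z, u z ∂(riemMeasure g) := by
  refine IsCompact.induction_on (p := fun s => ∃ C : NNReal, ∀ u : M → ℝ≥0∞, Measurable u →
      ∫⁻ z in s, u (S.Φ z) ∂(riemMeasure g) ≤ C * ∫⁻ z, u z ∂(riemMeasure g))
    S.hasCompactSupport_φ ⟨0, by simp⟩ ?_ ?_ ?_
  · rintro s t hst ⟨C, hC⟩
    exact ⟨C, fun u hu => (lintegral_mono_set hst).trans (hC u hu)⟩
  · rintro s t ⟨C, hC⟩ ⟨C', hC'⟩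
    refine ⟨C + C', fun u hu => (lintegral_union_le _ _ _).trans ?_⟩
    rw [ENNReal.coe_add, add_mul]
    exact add_le_add (hC u hu) (hC' u hu)
  · intro x hx
    obtain ⟨W, hWo, hxW, hWV, C, hC⟩ := S.exists_map_restrict_le_nhds g (S.tsupport_subset hx)
    refine ⟨W, mem_nhdsWithin_of_mem_nhds (hWo.mem_nhds hxW), C, fun u hu => ?_⟩
    have hΦ : AEMeasurable S.Φ ((riemMeasure g).restrict W) :=
      (S.Φ.contMDiffOn_toFun.continuousOn.mono hWV).aemeasurable hWo.measurableSet
    rw [← lintegral_map' hu.aemeasurable hΦ]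
    refine (lintegral_mono' hC le_rfl).trans (le_of_eq ?_)
    rw [lintegral_smul_measure]
    rfl

end SimpleH

end RiemannianMeasure

/-! ### Bounded operators on `Cʳ` and `Wʳₚ`, and independence of the representation. -/

section Operators

variable {d : ℕ} {M : Type*} [TopologicalSpace M] [ChartedSpace (Euc d) M]
  [IsManifold 𝓘(ℝ, Euc d) ∞ M]

namespace SimpleH

variable (S : SimpleH d M)

theorem act_add (f h : M → ℝ) : S.act (f + h) = S.act f + S.act h := by
  ext x
  by_cases hx : x ∈ S.V <;> simp [act, hx, mul_add]

theorem act_smul (c : ℝ) (f : M → ℝ) : S.act (c • f) = c • S.act f := by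
  ext x
  by_cases hx : x ∈ S.V <;> simp [act, hx, mul_left_comm]

theorem exists_crNorm_act_le (g : RiemMetric d M) (r : ℕ) :
    ∃ C : NNReal, ∀ f : M → ℝ, ContMDiff 𝓘(ℝ, Euc d) 𝓘(ℝ) (r : ℕ∞ω) f →
      crNorm g r (S.act f) ≤ C * crNorm g r f := by
  choose c hc using fun k => S.exists_covNorm_act_le g k
  refine ⟨∑ k ∈ Finset.range (r + 1), c k, fun f hf => ?_⟩
  rw [ENNReal.ofNNReal_finsetSum, Finset.sum_mul]
  refine Finset.sum_le_sum fun k hk => iSup_le fun x => ?_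
  have hkr : k ≤ r := Nat.lt_succ_iff.1 (Finset.mem_range.1 hk)
  by_cases hx : x ∈ tsupport S.φ
  · refine (hc k f (hf.of_le (by exact_mod_cast hkr)) x hx).trans (mul_le_mul_right ?_ _)
    refine (Finset.sum_le_sum fun j _ => le_iSup (covNorm g j f) (S.Φ x)).trans ?_
    exact Finset.sum_le_sum_of_subset (Finset.range_subset_range.2 (Nat.succ_le_succ hkr))
  · rw [S.covNorm_act_eq_zero g k f hx]
    exact bot_le

section Sobolev

variable [MeasurableSpace M] [BorelSpace M]

theorem exists_sobolevNorm_act_le (g : RiemMetric d M) (r : ℕ) {p : ℝ} (hp : 1 ≤ p) :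
    ∃ C : ℝ≥0∞, C ≠ ⊤ ∧ ∀ f : M → ℝ, ContMDiff 𝓘(ℝ, Euc d) 𝓘(ℝ) ∞ f →
      sobolevNorm g r p (S.act f) ≤ C * sobolevNorm g r p f := by
  have hp0 : 0 < p := zero_lt_one.trans_le hp
  obtain ⟨B, hB⟩ := S.exists_lintegral_comp_le g
  choose c hc using fun k => S.exists_covNorm_act_le g k
  -- `B` comes from transporting the measure and `c k` from the pointwise bound. The factor `(k + 1)
  -- ^ (p - 1)` is the convexity constant for a `p`-th power of `k + 1` summands, and the last `k +
  -- 1` counts integrals, each at most `N ^ p`.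
  let K : ℕ → ℝ≥0∞ := fun k =>
    (B * ((c k : ℝ≥0∞) ^ p * (((k + 1 : ℕ) : ℝ≥0∞) ^ (p - 1) * ((k + 1 : ℕ) : ℝ≥0∞)))) ^ (1 / p)
  have hK : ∀ k, K k ≠ ⊤ := fun k => by
    refine ENNReal.rpow_ne_top_of_nonneg (by positivity) ?_
    refine ENNReal.mul_ne_top ENNReal.coe_ne_top (ENNReal.mul_ne_top
      (ENNReal.rpow_ne_top_of_nonneg hp0.le ENNReal.coe_ne_top) (ENNReal.mul_ne_top
        (ENNReal.rpow_ne_top_of_nonneg (by linarith) (ENNReal.natCast_ne_top _))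
        (ENNReal.natCast_ne_top _)))
  refine ⟨∑ k ∈ Finset.range (r + 1), K k, ENNReal.sum_ne_top.2 fun k _ => hK k, fun f hf => ?_⟩
  have hfk : ∀ k : ℕ, ContMDiff 𝓘(ℝ, Euc d) 𝓘(ℝ) (k : ℕ∞ω) f := fun k =>
    hf.of_le (natCast_le_infty k)
  have hmeas : ∀ j, Measurable (covNorm g j f) := fun j => measurable_covNorm g j (hfk j)
  rw [Finset.sum_mul, sobolevNorm]
  refine Finset.sum_le_sum fun k hk => ?_
  have hkr : k ≤ r := Nat.lt_succ_iff.1 (Finset.mem_range.1 hk)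
  set N := sobolevNorm g r p f with hN
  have hj : ∀ j ∈ Finset.range (k + 1),
      ∫⁻ x, covNorm g j f x ^ p ∂(riemMeasure g) ≤ N ^ p := by
    intro j hj
    have hjr : j ∈ Finset.range (r + 1) := by
      rw [Finset.mem_range] at hj ⊢
      omega
    rw [← ENNReal.rpow_inv_le_iff hp0, ← one_div]
    exact Finset.single_le_sum
      (f := fun k => (∫⁻ x, covNorm g k f x ^ p ∂(riemMeasure g)) ^ (1 / p))
      (fun _ _ => bot_le) hjr
  have h1 : ∫⁻ x, covNorm g k (S.act f) x ^ p ∂(riemMeasure g)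
      ≤ ∫⁻ x in tsupport S.φ,
        (c k * ∑ j ∈ Finset.range (k + 1), covNorm g j f (S.Φ x)) ^ p ∂(riemMeasure g) := by
    rw [← lintegral_indicator (isClosed_tsupport S.φ).measurableSet]
    refine lintegral_mono fun x => ?_
    by_cases hx : x ∈ tsupport S.φ
    · rw [Set.indicator_of_mem hx]
      exact ENNReal.rpow_le_rpow (hc k f (hfk k) x hx) hp0.le
    · rw [Set.indicator_of_notMem hx, S.covNorm_act_eq_zero g k f hx, ENNReal.zero_rpow_of_pos hp0]
  have h2 := hB (fun w => (c k * ∑ j ∈ Finset.range (k + 1), covNorm g j f w) ^ p)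
    (((Finset.measurable_fun_sum _ fun j _ => hmeas j).const_mul _).pow_const p)
  have h3 : ∫⁻ w, (c k * ∑ j ∈ Finset.range (k + 1), covNorm g j f w) ^ p ∂(riemMeasure g)
      ≤ (c k : ℝ≥0∞) ^ p * (((k + 1 : ℕ) : ℝ≥0∞) ^ (p - 1) * (((k + 1 : ℕ) : ℝ≥0∞) * N ^ p)) := by
    simp only [ENNReal.mul_rpow_of_nonneg _ _ hp0.le]
    rw [lintegral_const_mul _ ((Finset.measurable_fun_sum _ fun j _ => hmeas j).pow_const p)]
    refine mul_le_mul_right ?_ _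
    refine (lintegral_mono fun w => ENNReal.rpow_sum_le_const_mul_sum_rpow _ _ hp).trans ?_
    rw [lintegral_const_mul _ (Finset.measurable_fun_sum _ fun j _ => (hmeas j).pow_const p),
      lintegral_finsetSum _ fun j _ => (hmeas j).pow_const p, Finset.card_range]
    refine mul_le_mul_right ?_ _
    refine (Finset.sum_le_sum hj).trans (le_of_eq ?_)
    rw [Finset.sum_const, Finset.card_range, nsmul_eq_mul]
  have h4 := h1.trans (h2.trans (mul_le_mul_right h3 _))
  refine (ENNReal.rpow_le_rpow h4 (by positivity)).trans (le_of_eq ?_)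
  rw [← mul_assoc (((k + 1 : ℕ) : ℝ≥0∞) ^ (p - 1)), ← mul_assoc ((c k : ℝ≥0∞) ^ p), ← mul_assoc,
    ENNReal.mul_rpow_of_nonneg _ _ (by positivity), ← ENNReal.rpow_mul, mul_one_div_cancel hp0.ne',
    ENNReal.rpow_one]

/-- A simple H-operator as a bounded operator on smooth functions with finite `Wʳₚ`-norm. -/
theorem exists_clm_smoothSobolev (g : RiemMetric d M) (r : ℕ) {p : ℝ} (hp : 1 ≤ p) :
    ∃ T : SmoothSobolev g r p hp →L[ℝ] SmoothSobolev g r p hp,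
      ∀ f, (T f).toFun = S.act f.toFun := by
  obtain ⟨C, hC, h⟩ := S.exists_sobolevNorm_act_le g r hp
  let L : SmoothSobolev g r p hp →ₗ[ℝ] SmoothSobolev g r p hp :=
    { toFun := fun f => (⟨S.act f.toFun, S.contMDiff_act le_rfl f.property.1,
        (h _ f.property.1).trans_lt (ENNReal.mul_lt_top hC.lt_top f.property.2)⟩ :
          ↥(sobolevSubmodule g r p hp))
      map_add' := fun f h => Subtype.ext (S.act_add _ _)
      map_smul' := fun c f => Subtype.ext (S.act_smul _ _) }
  refine ⟨L.mkContinuous C.toReal fun f => ?_, fun f => rfl⟩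
  rw [SmoothSobolev.norm_def, SmoothSobolev.norm_def, ← ENNReal.toReal_mul]
  exact ENNReal.toReal_mono (ENNReal.mul_ne_top hC f.property.2.ne) (h _ f.property.1)

end Sobolev

theorem exists_clm_crSpace (g : RiemMetric d M) (r : ℕ) :
    ∃ T : CrSpace g r →L[ℝ] CrSpace g r, ∀ f, (T f).toFun = S.act f.toFun := by
  obtain ⟨C, h⟩ := S.exists_crNorm_act_le g r
  let L : CrSpace g r →ₗ[ℝ] CrSpace g r :=
    { toFun := fun f => (⟨S.act f.toFun, S.contMDiff_act (natCast_le_infty r) f.property.1,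
        (h _ f.property.1).trans_lt (ENNReal.mul_lt_top ENNReal.coe_lt_top f.property.2)⟩ :
          ↥(crSubmodule g r))
      map_add' := fun f h => Subtype.ext (S.act_add _ _)
      map_smul' := fun c f => Subtype.ext (S.act_smul _ _) }
  refine ⟨L.mkContinuous (C : ℝ≥0∞).toReal fun f => ?_, fun f => rfl⟩
  rw [CrSpace.norm_def, CrSpace.norm_def, ← ENNReal.toReal_mul]
  exact ENNReal.toReal_mono (ENNReal.mul_ne_top ENNReal.coe_ne_top f.property.2.ne)
    (h _ f.property.1)

end SimpleH

/-- The action of an H-operator on continuous functions does not depend on the representation. -/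
theorem sum_act_eq_of_represents [T2Space M] {H : C₀(M, ℝ) →L[ℝ] C₀(M, ℝ)} {m n : ℕ}
    {S : Fin m → SimpleH d M} {S' : Fin n → SimpleH d M} (hS : Represents S H)
    (hS' : Represents S' H) {f : M → ℝ} (hf : Continuous f) (x : M) :
    ∑ i, (S i).act f x = ∑ i, (S' i).act f x := by
  have : LocallyCompactSpace M := ChartedSpace.locallyCompactSpace (Euc d) M
  -- Both sums at `x` read `f` only at these finitely many points. A compactly supported cutoff
  -- equal to one on `A` replaces `f` by an element of `C₀(M)` without changing either sum, and
  -- there both equal `H F x`.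
  let A : Set M := Set.range (fun i => (S i).Φ x) ∪ Set.range (fun i => (S' i).Φ x)
  have hA : A.Finite := (Set.finite_range _).union (Set.finite_range _)
  obtain ⟨χ, hχ1, -, hχ, -⟩ := exists_continuous_one_zero_of_isCompact hA.isCompact isClosed_empty
    (Set.disjoint_empty A)
  have hc : HasCompactSupport fun z => χ z * f z := hχ.mul_right
  let F : C₀(M, ℝ) :=
    { toFun := fun z => χ z * f z
      continuous_toFun := χ.continuous.mul hf
      zero_at_infty' := hc.is_zero_at_infty }
  have hact : ∀ T : SimpleH d M, T.Φ x ∈ A → T.act F x = T.act f x := by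
    intro T hT
    have hF : F (T.Φ x) = f (T.Φ x) := by
      change χ (T.Φ x) * f (T.Φ x) = _
      rw [hχ1 hT, Pi.one_apply, one_mul]
    simp only [SimpleH.act, hF]
  have hH : ∀ {k : ℕ} {R : Fin k → SimpleH d M}, Represents R H →
      H F x = ∑ i, (R i).act F x := by
    intro k R hR
    let ev : C₀(M, ℝ) →+ ℝ :=
      { toFun := fun G => G x, map_zero' := rfl, map_add' := fun _ _ => rfl }
    rw [show H = ∑ i, (R i).toC0 from hR, sum_apply]
    exact map_sum ev _ _
  calc ∑ i, (S i).act f x = ∑ i, (S i).act F x :=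
        Finset.sum_congr rfl fun i _ => (hact _ (Or.inl ⟨i, rfl⟩)).symm
    _ = ∑ i, (S' i).act F x := (hH hS).symm.trans (hH hS')
    _ = ∑ i, (S' i).act f x := Finset.sum_congr rfl fun i _ => hact _ (Or.inr ⟨i, rfl⟩)

/-- `ActsTo` quantifies over all representations; for continuous functions one of them suffices. -/
theorem actsTo_of_represents [T2Space M] {H : C₀(M, ℝ) →L[ℝ] C₀(M, ℝ)} {n : ℕ}
    {S : Fin n → SimpleH d M} (hS : Represents S H) {f h : M → ℝ} (hf : Continuous f)
    (hh : h = ∑ i, (S i).act f) : ActsTo (d := d) H f h := by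
  intro m S' hS' x
  rw [hh, Finset.sum_apply]
  exact sum_act_eq_of_represents hS hS' hf x

end Operators

end Hestenes

end

/-! ### The boundedness theorem. -/

theorem mainTheorem7 {d : ℕ} {M : Type*} [TopologicalSpace M] [T2Space M]
    [SecondCountableTopology M] [ConnectedSpace M]
    [ChartedSpace (EuclideanSpace ℝ (Fin d)) M]
    [IsManifold 𝓘(ℝ, EuclideanSpace ℝ (Fin d)) ∞ M]
    [MeasurableSpace M] [BorelSpace M]
    (g : Hestenes.RiemMetric d M)
    (U : Set M) (hU : IsOpen U) (hUc : IsCompact (closure U))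
    (H : C₀(M, ℝ) →L[ℝ] C₀(M, ℝ)) (hH : Hestenes.IsLocalizedHOperator (d := d) H U) :
    (∀ r : ℕ, ∃ T : Hestenes.CrSpace g r →L[ℝ] Hestenes.CrSpace g r,
      ∀ f : Hestenes.CrSpace g r, Hestenes.ActsTo (d := d) H f.toFun (T f).toFun) ∧
    (∀ (r : ℕ) (p : ℝ) (hp : 1 ≤ p),
      ∃ T : Hestenes.Sobolev g r p hp →L[ℝ] Hestenes.Sobolev g r p hp,
        ∀ f : Hestenes.SmoothSobolev g r p hp, ∃ h : Hestenes.SmoothSobolev g r p hp,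
          Hestenes.ActsTo (d := d) H f.toFun h.toFun ∧
            T (Hestenes.toSobolev f) = Hestenes.toSobolev h) := by
  obtain ⟨n, S, -, hS⟩ := hH
  refine ⟨fun r => ?_, fun r p hp => ?_⟩
  · choose T hT using fun i => (S i).exists_clm_crSpace g r
    refine ⟨∑ i, T i, fun f => Hestenes.actsTo_of_represents hS f.property.1.continuous ?_⟩
    -- Passing to the underlying function is linear, hence commutes with the finite sum of
    -- operators.
    let ι : Hestenes.CrSpace g r →ₗ[ℝ] (M → ℝ) := (Hestenes.crSubmodule g r).subtype
    have h : ι ((∑ i, T i) f) = ∑ i, ι (T i f) := by rw [sum_apply, map_sum]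
    exact h.trans (Finset.sum_congr rfl fun i _ => hT i f)
  · choose T hT using fun i => (S i).exists_clm_smoothSobolev g r hp
    let J := UniformSpace.Completion.toComplL (𝕜 := ℝ) (E := Hestenes.SmoothSobolev g r p hp)
    -- The bounded operator on smooth functions, followed by the map `J` into the completion, is
    -- extended along `J` itself, which has dense range and is uniformly inducing.
    refine ⟨(J.comp (∑ i, T i)).extend J, fun f => ⟨(∑ i, T i) f,
      Hestenes.actsTo_of_represents hS f.property.1.continuous ?_, ?_⟩⟩
    · let ι : Hestenes.SmoothSobolev g r p hp →ₗ[ℝ] (M → ℝ) :=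
        (Hestenes.sobolevSubmodule g r p hp).subtype
      have h : ι ((∑ i, T i) f) = ∑ i, ι (T i f) := by rw [sum_apply, map_sum]
      exact h.trans (Finset.sum_congr rfl fun i _ => hT i f)
    · exact ContinuousLinearMap.extend_eq _ UniformSpace.Completion.denseRange_coe
        (UniformSpace.Completion.isUniformInducing_coe _) f
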